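/- For an even integer $n\ge 2$ let $\Lambda_n=\{-n/2+1,\dots,n/2\}$, let $$(\mathcal F_n z)_k=\frac1{\sqrt n}\sum_{j=0}^{n-1}z_j e^{-2\pi i kj/n}\qquad(k\in\Lambda_n)$$ be the discrete Fourier transform of $z\in\mathbb C^n$, let $P_\Omega$ be the restriction of a vector indexed by $\Lambda_n$ to the index set $\Omega\subseteq\Lambda_n$, and let $(\nabla z)_j=z_j-z_{(j-1)\bmod n}$ be the periodic finite-difference gradient. A vector is called $s$-sparse if it has at most $s$ nonzero entries. For every $\varepsilon_0\in(0,1)$ there is a constant $C>0$, depending only on $\varepsilon_0$, such that the following holds for every even $n\ge2$, every $s\in\mathbb N$, every $x\in\mathbb C^n$ such that $\nabla x$ is $s$-sparse, every $\varepsilon\in(0,\varepsilon_0]$ and every integer $m_n\ge0$ with $$m_n\ \ge\ C\,s\,\log(n)\,\log(\varepsilon^{-1}).$$ Let $\Omega_n=\{0\}\cup\Omega'$, where $\Omega'$ consists of $m_n$ indices chosen uniformly at random from $\Lambda_n$: either $m_n\le n$ and $\Omega'$ is a uniformly random subset of $\Lambda_n$ with exactly $m_n$ elements, or $\Omega'$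 is the set of values of $m_n$ independent uniformly distributed draws from $\Lambda_n$. In both cases, with probability at least $1-\varepsilon$, $x$ is the unique solution of $$\min_{z\in\mathbb C^n}\|\nabla z\|_1\quad\text{subject to}\quad P_{\Omega_n}\mathcal F_n z=P_{\Omega_n}\mathcal F_n x .$$ -/

import Mathlib

open scoped BigOperators

/-- The frequency set `{-n/2+1, …, n/2}` (used for even `n ≥ 2`). -/
noncomputable def freqs (n : ℕ) : Finset ℤ := Finset.Icc (-((n : ℤ) / 2) + 1) ((n : ℤ) / 2)

/-- The unitary one-dimensional discrete Fourier transform on `ℂⁿ`: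
`(F_n z)_k = n^{-1/2} ∑_{j=0}^{n-1} z_j exp(-2πi k j / n)`. The index `k` is only ever taken from
`freqs n`. -/
noncomputable def dft (n : ℕ) (z : Fin n → ℂ) (k : ℤ) : ℂ :=
  (1 / (Real.sqrt n : ℂ)) *
    ∑ j : Fin n, z j * Complex.exp (-2 * Real.pi * Complex.I * (k : ℂ) * ((j : ℕ) : ℂ) / (n : ℂ))

/-- The measurement operator `P_Ω ∘ F_n`, with values in `ℂ^Ω`. -/
noncomputable def sample (n : ℕ) (Ω : Finset ℤ) (z : Fin n → ℂ) : {k : ℤ // k ∈ Ω} → ℂ :=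
  fun k => dft n z k

/-- The periodic finite-difference gradient `(∇z)_j = z_j - z_{(j-1) mod n}`. -/
def grad {n : ℕ} (z : Fin n → ℂ) : Fin n → ℂ :=
  fun j => z j - z ⟨((j : ℕ) + (n - 1)) % n, Nat.mod_lt _ j.pos⟩

/-- A vector is `s`-sparse if it has at most `s` nonzero entries. -/
def IsSparse {n : ℕ} (s : ℕ) (z : Fin n → ℂ) : Prop := {j : Fin n | z j ≠ 0}.ncard ≤ s

/-- The `ℓ¹` norm on `ℂⁿ`. -/
noncomputable def l1norm {n : ℕ} (z : Fin n → ℂ) : ℝ := ∑ j, ‖z j‖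

/-- `x` is the unique solution of `min f(z)` subject to `z ∈ S`: it is a minimiser of `f` over `S`,
and every minimiser of `f` over `S` equals `x`. -/
def IsUniqueMinimizer {α : Type*} (f : α → ℝ) (S : Set α) (x : α) : Prop :=
  (x ∈ S ∧ IsMinOn f S x) ∧ ∀ y, y ∈ S → IsMinOn f S y → y = x

/-- Total-variation minimisation with sampling mask `Ω` recovers `x`: `x` is the unique solution of
`min ‖∇z‖₁` subject to `P_Ω F_n z = P_Ω F_n x`. -/
def TVRecovers (n : ℕ) (Ω : Finset ℤ) (x : Fin n → ℂ) : Prop :=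
  IsUniqueMinimizer (fun z : Fin n → ℂ => l1norm (grad z))
    {z | sample n Ω z = sample n Ω x} x

/-- The law of `Ω'` when it is a uniformly random subset of `freqs n` with exactly `m` elements. -/
noncomputable def subsetLaw (n m : ℕ) : MeasureTheory.Measure (Finset ℤ) :=
  ProbabilityTheory.uniformOn {T : Finset ℤ | T ⊆ freqs n ∧ T.card = m}

/-- The law of `m` independent uniformly distributed draws from `freqs n` (with replacement), that
is, the uniform distribution on `(freqs n)^m`. -/
noncomputable def drawsLaw (n m : ℕ) : MeasureTheory.Measure (Fin m → ℤ) :=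
  ProbabilityTheory.uniformOn {ω : Fin m → ℤ | ∀ i, ω i ∈ freqs n}

/-! ### Adaptive Kaczmarz iteration -/

/-! The gradient acts on Fourier coefficients by multipliers, so a feasible `z` differs from `x` by
a vector whose gradient `v` is orthogonal to all sampled characters, and frequency 0 forces `v ≠ 0`
unless `z = x`. With `S` the support of `∇x` and `σ` its phases, recovery follows if `|⟨σ, v⟩| <
‖v‖₁` off `S` for all such `v ≠ 0` (`tvRecovers_of_nullSpaceProperty`).

This null space property comes from an inexact dual certificate. Starting at `σ`, each draw `k`
subtracts a multiple of the character `a k` chosen to shrink the residual on `S`; pairings with `v`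
do not change. The final vector should be tiny on `S` and at most 1/2 off `S`. The same iteration
started at the unit vectors of `S` bounds `v` on `S` by `v` off `S`
(`nullSpaceProperty_of_certificates`).

The step size `1 / (s (1 + μT))`, with `s = |S|`, `T` the residual norm on `S` and `μ = K / √s`,
balances two effects. On average `T² exp(μT)` contracts by `1 - 1/(4s)` per draw
(`sum_potential_kaczmarzStep_le`). Off `S` every coordinate is a martingale with increments at most
`1/K` and conditional variance at most `1/(K² s)`, so exponential moments control it
(`sum_exp_kaczmarzStep_le`). With `K` of order `log n`, about `s log n` draws succeed with
probability at least 1/2 (`card_not_nullSpaceProperty_le_half`).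

Failure on `m` draws means failure on each of `b` disjoint blocks, which has probability at most
`2^(-b)`; this yields the factor `log ε⁻¹` (`drawCount_le_half_pow`). Averaging over permutations
transfers the bound to random subsets (`card_powersetCard_filter_mul_le`). -/

section Kaczmarz

variable {ι κ : Type*} (a : κ → ι → ℂ) (S : Finset ι) (μ : ℝ)

/-- The euclidean norm of the restriction of `w` to `S`. -/
noncomputable def localNorm (w : ι → ℂ) : ℝ := Real.sqrt (∑ j ∈ S, ‖w j‖ ^ 2)

/-- The correlation of `a k` with the restriction of `w` to `S`. -/
noncomputable def correlation (k : κ) (w : ι → ℂ) : ℂ := ∑ j ∈ S, starRingEnd ℂ (a k j) * w j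

/-- The step size of the Kaczmarz iteration; it grows as the residual shrinks. -/
noncomputable def stepSize (w : ι → ℂ) : ℝ := 1 / (S.card * (1 + μ * localNorm S w))

/-- One step of the adaptive Kaczmarz iteration. -/
noncomputable def kaczmarzStep (k : κ) (w : ι → ℂ) : ι → ℂ :=
  fun j => w j - stepSize S μ w * correlation a S k w * a k j

/-- The adaptive Kaczmarz iteration along a sequence of measurement indices. -/
noncomputable def kaczmarz : (N : ℕ) → (Fin N → κ) → (ι → ℂ) → ι → ℂ
  | 0, _, w => w
  | N + 1, ω, w => kaczmarz N (Fin.tail ω) (kaczmarzStep a S μ (ω 0) w)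

theorem localNorm_nonneg (w : ι → ℂ) : 0 ≤ localNorm S w := Real.sqrt_nonneg _

theorem localNorm_sq (w : ι → ℂ) : localNorm S w ^ 2 = ∑ j ∈ S, ‖w j‖ ^ 2 :=
  Real.sq_sqrt (Finset.sum_nonneg fun _ _ => sq_nonneg _)

theorem norm_le_localNorm (w : ι → ℂ) {j : ι} (hj : j ∈ S) : ‖w j‖ ≤ localNorm S w := by
  apply Real.le_sqrt_of_sq_le
  exact Finset.single_le_sum (f := fun j => ‖w j‖ ^ 2) (fun _ _ => sq_nonneg _) hj

/-- A bound of the average of `F` over one step yields a bound over the whole iteration. -/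
theorem sum_kaczmarz_le [Fintype κ] {F : (ι → ℂ) → ℝ} {γ : ℝ} (hγ : 0 ≤ γ)
    (h : ∀ w, ∑ k, F (kaczmarzStep a S μ k w) ≤ γ * F w) (N : ℕ) (w : ι → ℂ) :
    ∑ ω : Fin N → κ, F (kaczmarz a S μ N ω w) ≤ γ ^ N * F w := by
  induction N generalizing w with
  | zero => simp [kaczmarz]
  | succ N ih =>
    -- The iteration uses `ω 0` first, so the induction conditions on the first draw and generalizes
    -- over the starting vector.
    rw [← (Fin.consEquiv fun _ : Fin (N + 1) => κ).sum_comp, Fintype.sum_prod_type]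
    calc _ = ∑ k, ∑ ω : Fin N → κ, F (kaczmarz a S μ N ω (kaczmarzStep a S μ k w)) := by
          simp [kaczmarz, Fin.consEquiv]
      _ ≤ ∑ k, γ ^ N * F (kaczmarzStep a S μ k w) := Finset.sum_le_sum fun k _ => ih _
      _ = γ ^ N * ∑ k, F (kaczmarzStep a S μ k w) := by rw [Finset.mul_sum]
      _ ≤ γ ^ N * (γ * F w) := mul_le_mul_of_nonneg_left (h w) (pow_nonneg hγ N)
      _ = γ ^ (N + 1) * F w := by ring

variable {a S μ}

theorem stepSize_pos (hS : S.Nonempty) (hμ : 0 ≤ μ) (w : ι → ℂ) : 0 < stepSize S μ w := by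
  have h1 : (0 : ℝ) < S.card := by exact_mod_cast hS.card_pos
  have h2 := mul_nonneg hμ (localNorm_nonneg S w)
  unfold stepSize
  positivity

theorem card_mul_stepSize (hS : S.Nonempty) (hμ : 0 ≤ μ) (w : ι → ℂ) :
    stepSize S μ w * S.card * (1 + μ * localNorm S w) = 1 := by
  have h1 : (0 : ℝ) < S.card := by exact_mod_cast hS.card_pos
  have h2 := mul_nonneg hμ (localNorm_nonneg S w)
  have h3 : 0 < 1 + μ * localNorm S w := by linarith
  unfold stepSize
  field_simp

theorem stepSize_mul_card_le (hS : S.Nonempty) (hμ : 0 ≤ μ) (w : ι → ℂ) :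
    stepSize S μ w * S.card ≤ 1 := by
  have h0 := (stepSize_pos hS hμ w).le
  have h2 := mul_nonneg hμ (localNorm_nonneg S w)
  have := card_mul_stepSize hS hμ w
  have h3 : (0 : ℝ) ≤ S.card := by positivity
  nlinarith [mul_nonneg (mul_nonneg h0 h3) h2]

/-- Expand the square: the cross terms sum to `|c|²` because `c` is itself the correlation, and
unimodularity makes the quadratic terms constant in `j`. -/
theorem sum_norm_sq_sub_smul (ha : ∀ k j, ‖a k j‖ = 1) (k : κ) (w : ι → ℂ) (η : ℝ) :
    ∑ j ∈ S, ‖w j - η * correlation a S k w * a k j‖ ^ 2 =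
      localNorm S w ^ 2 - (2 * η - η ^ 2 * S.card) * ‖correlation a S k w‖ ^ 2 := by
  set c := correlation a S k w with hc
  have key : ∀ j, ‖w j - η * c * a k j‖ ^ 2 =
      ‖w j‖ ^ 2 - 2 * η * (starRingEnd ℂ c * (starRingEnd ℂ (a k j) * w j)).re
        + η ^ 2 * ‖c‖ ^ 2 := by
    intro j
    have h1 : ‖a k j‖ ^ 2 = 1 := by rw [ha]; norm_num
    have h2 : ‖w j - η * c * a k j‖ ^ 2 = ‖w j‖ ^ 2
        - 2 * η * (starRingEnd ℂ c * (starRingEnd ℂ (a k j) * w j)).re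
        + η ^ 2 * ‖c‖ ^ 2 * ‖a k j‖ ^ 2 := by
      simp only [Complex.sq_norm, Complex.normSq_apply, Complex.sub_re, Complex.sub_im,
        Complex.mul_re, Complex.mul_im, Complex.ofReal_re, Complex.ofReal_im, Complex.conj_re,
        Complex.conj_im]
      ring
    rw [h2, h1, mul_one]
  have hre : ∑ j ∈ S, (starRingEnd ℂ c * (starRingEnd ℂ (a k j) * w j)).re = ‖c‖ ^ 2 := by
    rw [← Complex.re_sum, ← Finset.mul_sum]
    change (starRingEnd ℂ c * c).re = _
    rw [mul_comm, Complex.mul_conj, Complex.ofReal_re, Complex.sq_norm]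
  rw [Finset.sum_congr rfl fun j _ => key j, Finset.sum_add_distrib, Finset.sum_sub_distrib,
    ← Finset.mul_sum, hre, localNorm_sq, Finset.sum_const, nsmul_eq_mul]
  ring

theorem localNorm_kaczmarzStep_sq (ha : ∀ k j, ‖a k j‖ = 1) (k : κ) (w : ι → ℂ) :
    localNorm S (kaczmarzStep a S μ k w) ^ 2 = localNorm S w ^ 2 -
      (2 * stepSize S μ w - stepSize S μ w ^ 2 * S.card) * ‖correlation a S k w‖ ^ 2 := by
  rw [← sum_norm_sq_sub_smul ha, localNorm_sq]
  rfl

theorem norm_correlation_sq_le (ha : ∀ k j, ‖a k j‖ = 1) (k : κ) (w : ι → ℂ) :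
    ‖correlation a S k w‖ ^ 2 ≤ S.card * localNorm S w ^ 2 := by
  rw [localNorm_sq]
  have h1 : ‖correlation a S k w‖ ≤ ∑ j ∈ S, ‖w j‖ := by
    refine (norm_sum_le _ _).trans (le_of_eq (Finset.sum_congr rfl fun j _ => ?_))
    rw [norm_mul, RCLike.norm_conj, ha, one_mul]
  exact (pow_le_pow_left₀ (norm_nonneg _) h1 2).trans sq_sum_le_card_mul_sum_sq

variable [Fintype κ] [DecidableEq ι]

/-- Parseval: the rows form a tight frame, so the average squared correlation is the squared
residual norm. -/
theorem sum_norm_correlation_sq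
    (hortho : ∀ t j, ∑ k, a k t * starRingEnd ℂ (a k j) = if t = j then (Fintype.card κ : ℂ) else 0)
    (w : ι → ℂ) :
    ∑ k, ‖correlation a S k w‖ ^ 2 = Fintype.card κ * localNorm S w ^ 2 := by
  have h : ∑ k, (starRingEnd ℂ (correlation a S k w)) * correlation a S k w =
      ∑ i ∈ S, ∑ j ∈ S, (∑ k, a k i * starRingEnd ℂ (a k j)) * (starRingEnd ℂ (w i) * w j) := by
    simp only [correlation, map_sum, map_mul, Complex.conj_conj, Finset.sum_mul]
    rw [Finset.sum_comm]
    refine Finset.sum_congr rfl fun i _ => ?_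
    rw [Finset.sum_comm]
    refine Finset.sum_congr rfl fun j _ => ?_
    rw [Finset.mul_sum]
    exact Finset.sum_congr rfl fun k _ => by ring
  apply Complex.ofReal_injective
  rw [localNorm_sq]
  push_cast
  simp only [← Complex.conj_mul']
  rw [h]
  simp only [hortho, ite_mul, zero_mul, Finset.sum_ite_eq, Finset.mul_sum]
  exact Finset.sum_congr rfl fun j hj => by rw [if_pos hj]

/-- Columns outside `S` are orthogonal to those inside, so the iteration has no drift off `S`: this
is the martingale property. -/
theorem sum_mul_correlation_eq_zero
    (hortho : ∀ t j, ∑ k, a k t * starRingEnd ℂ (a k j) = if t = j then (Fintype.card κ : ℂ) else 0)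
    {t : ι} (ht : t ∉ S) (w : ι → ℂ) :
    ∑ k, a k t * correlation a S k w = 0 := by
  simp only [correlation, Finset.mul_sum]
  rw [Finset.sum_comm]
  refine Finset.sum_eq_zero fun j hj => ?_
  have : t ≠ j := fun h => ht (h ▸ hj)
  simp only [← mul_assoc, ← Finset.sum_mul, hortho, if_neg this, zero_mul]

end Kaczmarz

/-! ### One-step estimates: contraction on `S`, exponential moments off `S` -/

section KaczmarzPotential

variable {ι κ : Type*} {a : κ → ι → ℂ} {S : Finset ι} {μ : ℝ}

/-- The damping `1 + μT` in the step size caps the size of a step independently of how large the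
residual is. -/
theorem stepSize_mul_localNorm_le (hS : S.Nonempty) (hμ : 0 ≤ μ) (w : ι → ℂ) :
    stepSize S μ w * localNorm S w * S.card * μ ≤ 1 := by
  have h0 := (stepSize_pos hS hμ w).le
  have := card_mul_stepSize hS hμ w
  have h3 : (0 : ℝ) ≤ S.card := by positivity
  nlinarith [mul_nonneg h0 h3]

theorem stepSize_sq_mul_localNorm_sq_le (hS : S.Nonempty) (hμ : 0 < μ) (w : ι → ℂ) :
    stepSize S μ w ^ 2 * localNorm S w ^ 2 ≤ 1 / (μ ^ 2 * S.card ^ 2) := by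
  have h1 : (0 : ℝ) < S.card := by exact_mod_cast hS.card_pos
  have h0 := (stepSize_pos hS hμ.le w).le
  have hT := localNorm_nonneg S w
  rw [le_div_iff₀ (by positivity)]
  have h2 := pow_le_one₀ (n := 2) (by positivity) (stepSize_mul_localNorm_le hS hμ.le w)
  linarith [h2, show (stepSize S μ w * localNorm S w * S.card * μ) ^ 2 =
    stepSize S μ w ^ 2 * localNorm S w ^ 2 * (μ ^ 2 * S.card ^ 2) by ring]

theorem stepSize_sq_mul_norm_correlation_sq_le (ha : ∀ k j, ‖a k j‖ = 1) (hS : S.Nonempty)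
    (hμ : 0 < μ) (k : κ) (w : ι → ℂ) :
    stepSize S μ w ^ 2 * ‖correlation a S k w‖ ^ 2 ≤ 1 / (μ ^ 2 * S.card) := by
  have h1 : (0 : ℝ) < S.card := by exact_mod_cast hS.card_pos
  calc stepSize S μ w ^ 2 * ‖correlation a S k w‖ ^ 2
      ≤ stepSize S μ w ^ 2 * (S.card * localNorm S w ^ 2) :=
        mul_le_mul_of_nonneg_left (norm_correlation_sq_le ha k w) (sq_nonneg _)
    _ = S.card * (stepSize S μ w ^ 2 * localNorm S w ^ 2) := by ring
    _ ≤ S.card * (1 / (μ ^ 2 * S.card ^ 2)) :=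
        mul_le_mul_of_nonneg_left (stepSize_sq_mul_localNorm_sq_le hS hμ w) h1.le
    _ = 1 / (μ ^ 2 * S.card) := by field_simp

theorem exp_neg_le_one_sub_half {z : ℝ} (h0 : 0 ≤ z) (h1 : z ≤ 1) : Real.exp (-z) ≤ 1 - z / 2 := by
  rw [Real.exp_neg, inv_le_iff_one_le_mul₀ (Real.exp_pos z)]
  nlinarith [Real.add_one_le_exp z]

/-- A potential that decreases when the residual norm `T` shrinks to `T'` by a Kaczmarz step. -/
theorem sq_mul_exp_le {T T' x : ℝ} (hT : 0 ≤ T) (hμ : 0 ≤ μ) (hx : 0 ≤ x)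
    (hx1 : x * (1 + μ * T) ≤ 2) (h : T' ^ 2 = T ^ 2 * (1 - x)) (hx2 : x ≤ 2) :
    T' ^ 2 * Real.exp (μ * T') ≤ T ^ 2 * Real.exp (μ * T) * (1 - x * (1 + μ * T) / 4) := by
  -- Uses `1 - x ≤ (1 - x/2)²`.
  have h1 : T' ≤ T * (1 - x / 2) := by
    apply le_of_sq_le_sq _ (mul_nonneg hT (by linarith))
    rw [h]; nlinarith [sq_nonneg (T * x)]
  have hμT := mul_nonneg hμ hT
  have h2 : 1 - x ≤ Real.exp (-x) := by linarith [Real.add_one_le_exp (-x)]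
  have h3 : Real.exp (-(x * (1 + μ * T) / 2)) ≤ 1 - x * (1 + μ * T) / 2 / 2 :=
    exp_neg_le_one_sub_half (by positivity) (by linarith)
  calc T' ^ 2 * Real.exp (μ * T') ≤ T ^ 2 * Real.exp (-x) * Real.exp (μ * (T * (1 - x / 2))) := by
        gcongr
        rw [h]; gcongr
    _ = T ^ 2 * Real.exp (μ * T) * Real.exp (-x + -(x * (μ * T) / 2)) := by
        rw [mul_assoc, mul_assoc, ← Real.exp_add, ← Real.exp_add]; ring_nf
    _ ≤ T ^ 2 * Real.exp (μ * T) * Real.exp (-(x * (1 + μ * T) / 2)) := by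
        gcongr; linarith
    _ ≤ _ := by
        gcongr; linarith

variable [Fintype κ] [DecidableEq ι]

/-- Damping slows the mean relative decrease of `T²` to order `1 / (s (1 + μT))`, but the weight
`exp(μT)` gains back the factor `1 + μT`, so the contraction rate does not depend on `T`. -/
theorem sum_potential_kaczmarzStep_le (ha : ∀ k j, ‖a k j‖ = 1)
    (hortho : ∀ t j, ∑ k, a k t * starRingEnd ℂ (a k j) = if t = j then (Fintype.card κ : ℂ) else 0)
    (hS : S.Nonempty) (hμ : 0 ≤ μ) (w : ι → ℂ) :
    ∑ k, localNorm S (kaczmarzStep a S μ k w) ^ 2 *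
        Real.exp (μ * localNorm S (kaczmarzStep a S μ k w)) ≤
      Fintype.card κ * (1 - 1 / (4 * S.card)) *
        (localNorm S w ^ 2 * Real.exp (μ * localNorm S w)) := by
  have hs : (0 : ℝ) < S.card := by exact_mod_cast hS.card_pos
  set T := localNorm S w with hTdef
  set η := stepSize S μ w with hη
  have hT : 0 ≤ T := localNorm_nonneg S w
  have hη0 : 0 < η := stepSize_pos hS hμ w
  have hη1 : η * S.card * (1 + μ * T) = 1 := card_mul_stepSize hS hμ w
  have hη2 : η * S.card ≤ 1 := stepSize_mul_card_le hS hμ w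
  have hμT := mul_nonneg hμ hT
  set δ := 2 * η - η ^ 2 * S.card with hδ
  have hδ1 : η ≤ δ := by nlinarith
  have hδ2 : δ ≤ 2 * η := by nlinarith [mul_nonneg (sq_nonneg η) hs.le]
  have hstep : ∀ k, localNorm S (kaczmarzStep a S μ k w) ^ 2 *
        Real.exp (μ * localNorm S (kaczmarzStep a S μ k w)) ≤
      Real.exp (μ * T) * (T ^ 2 - δ * (1 + μ * T) / 4 * ‖correlation a S k w‖ ^ 2) := by
    intro k
    have h1 : localNorm S (kaczmarzStep a S μ k w) ^ 2 = T ^ 2 - δ * ‖correlation a S k w‖ ^ 2 :=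
      localNorm_kaczmarzStep_sq ha k w
    have h2 : ‖correlation a S k w‖ ^ 2 ≤ S.card * T ^ 2 := norm_correlation_sq_le ha k w
    -- The relative decrease `x = δp / T²` needs `T ≠ 0`; for `T = 0` the step changes nothing on
    -- `S`.
    rcases hT.eq_or_lt with h0 | hTpos
    · have h4 : ‖correlation a S k w‖ ^ 2 = 0 :=
        le_antisymm (by rw [← h0] at h2; simpa using h2) (sq_nonneg _)
      rw [h1, h4, ← h0]; simp
    · set p := ‖correlation a S k w‖ ^ 2 with hp
      have hp0 : 0 ≤ p := sq_nonneg _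
      have hδ0 : 0 ≤ δ := hη0.le.trans hδ1
      have hx : δ * p / T ^ 2 ≤ 2 * η * S.card := by
        rw [div_le_iff₀ (by positivity)]
        calc δ * p ≤ 2 * η * (S.card * T ^ 2) := by gcongr
          _ = _ := by ring
      have hx0 : 0 ≤ δ * p / T ^ 2 := by positivity
      have := sq_mul_exp_le (μ := μ) (x := δ * p / T ^ 2) hT hμ hx0
        (by
          calc δ * p / T ^ 2 * (1 + μ * T) ≤ 2 * η * S.card * (1 + μ * T) := by gcongr
            _ = 2 := by linarith)
        (by rw [h1]; field_simp) (by linarith)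
      refine this.trans (le_of_eq ?_)
      field_simp
  refine (Finset.sum_le_sum fun k _ => hstep k).trans ?_
  rw [← Finset.mul_sum, Finset.sum_sub_distrib, ← Finset.mul_sum, sum_norm_correlation_sq hortho,
    Finset.sum_const, nsmul_eq_mul, Finset.card_univ, ← hTdef]
  have h5 : 1 / (4 * S.card : ℝ) ≤ δ * (1 + μ * T) / 4 := by
    rw [div_le_iff₀ (by positivity)]
    have : η * (1 + μ * T) ≤ δ * (1 + μ * T) := by gcongr
    nlinarith [mul_le_mul_of_nonneg_right this hs.le]
  calc _ = Fintype.card κ * (1 - δ * (1 + μ * T) / 4) * (T ^ 2 * Real.exp (μ * T)) := by ring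
    _ ≤ _ := by gcongr

theorem exp_le_one_add_add_sq {x : ℝ} (hx : x ^ 2 ≤ 1) : Real.exp x ≤ 1 + x + x ^ 2 := by
  have := (abs_le.mp (Real.abs_exp_sub_one_sub_id_le ((sq_le_one_iff_abs_le_one x).mp hx))).2
  linarith

/-- Bernstein-type moment bound: the increment `X` has mean zero and, by the condition on `l`, size
at most 1, so `exp X ≤ 1 + X + X²` leaves only its variance. -/
theorem sum_exp_kaczmarzStep_le (ha : ∀ k j, ‖a k j‖ = 1)
    (hortho : ∀ t j, ∑ k, a k t * starRingEnd ℂ (a k j) = if t = j then (Fintype.card κ : ℂ) else 0)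
    (hS : S.Nonempty) (hμ : 0 < μ) {t : ι} (ht : t ∉ S) {θ : ℂ} (hθ : ‖θ‖ = 1) {l : ℝ}
    (hl : l ^ 2 ≤ μ ^ 2 * S.card) (w : ι → ℂ) :
    ∑ k, Real.exp (l * (θ * kaczmarzStep a S μ k w t).re) ≤
      Fintype.card κ * Real.exp (l ^ 2 / (μ ^ 2 * S.card ^ 2)) * Real.exp (l * (θ * w t).re) := by
  have hs : (0 : ℝ) < S.card := by exact_mod_cast hS.card_pos
  set η := stepSize S μ w with hη
  set X : κ → ℝ := fun k => -(l * η) * (θ * (a k t * correlation a S k w)).re with hX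
  have hstep : ∀ k, l * (θ * kaczmarzStep a S μ k w t).re = l * (θ * w t).re + X k := by
    intro k
    have : θ * kaczmarzStep a S μ k w t =
        θ * w t - η * (θ * (a k t * correlation a S k w)) := by
      simp only [kaczmarzStep]; ring
    rw [this, Complex.sub_re, Complex.re_ofReal_mul]
    simp only [hX]; ring
  have hXsq : ∀ k, X k ^ 2 ≤ l ^ 2 * (η ^ 2 * ‖correlation a S k w‖ ^ 2) := by
    intro k
    have h1 : (θ * (a k t * correlation a S k w)).re ^ 2 ≤ ‖correlation a S k w‖ ^ 2 := by
      have := Complex.abs_re_le_norm (θ * (a k t * correlation a S k w))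
      rw [norm_mul, norm_mul, hθ, ha, one_mul, one_mul] at this
      rw [← sq_abs]
      exact pow_le_pow_left₀ (abs_nonneg _) this 2
    calc X k ^ 2 = l ^ 2 * (η ^ 2 * (θ * (a k t * correlation a S k w)).re ^ 2) := by
          simp only [hX]; ring
      _ ≤ _ := by gcongr
  have hX1 : ∀ k, X k ^ 2 ≤ 1 := by
    intro k
    refine (hXsq k).trans ?_
    calc l ^ 2 * (η ^ 2 * ‖correlation a S k w‖ ^ 2) ≤ (μ ^ 2 * S.card) * (1 / (μ ^ 2 * S.card)) := by
          gcongr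
          exact stepSize_sq_mul_norm_correlation_sq_le ha hS hμ k w
      _ = 1 := by field_simp
  have hXsum : ∑ k, X k = 0 := by
    simp only [hX]
    rw [← Finset.mul_sum, ← Complex.re_sum, ← Finset.mul_sum,
      sum_mul_correlation_eq_zero hortho ht]
    simp
  have hsum : ∑ k, X k ^ 2 ≤ Fintype.card κ * (l ^ 2 / (μ ^ 2 * S.card ^ 2)) := by
    calc ∑ k, X k ^ 2 ≤ ∑ k, l ^ 2 * (η ^ 2 * ‖correlation a S k w‖ ^ 2) :=
          Finset.sum_le_sum fun k _ => hXsq k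
      _ = Fintype.card κ * (l ^ 2 * (η ^ 2 * localNorm S w ^ 2)) := by
          rw [← Finset.mul_sum, ← Finset.mul_sum, sum_norm_correlation_sq hortho]; ring
      _ ≤ Fintype.card κ * (l ^ 2 * (1 / (μ ^ 2 * S.card ^ 2))) := by
          gcongr
          exact stepSize_sq_mul_localNorm_sq_le hS hμ w
      _ = _ := by ring
  calc ∑ k, Real.exp (l * (θ * kaczmarzStep a S μ k w t).re)
      = Real.exp (l * (θ * w t).re) * ∑ k, Real.exp (X k) := by
        rw [Finset.mul_sum]
        exact Finset.sum_congr rfl fun k _ => by rw [hstep, Real.exp_add]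
    _ ≤ Real.exp (l * (θ * w t).re) * ∑ k, (1 + X k + X k ^ 2) := by
        gcongr with k
        exact exp_le_one_add_add_sq (hX1 k)
    _ = Real.exp (l * (θ * w t).re) * (Fintype.card κ + ∑ k, X k ^ 2) := by
        rw [Finset.sum_add_distrib, Finset.sum_add_distrib, hXsum, Finset.sum_const, nsmul_eq_mul,
          Finset.card_univ]
        ring
    _ ≤ Real.exp (l * (θ * w t).re) *
          (Fintype.card κ * (l ^ 2 / (μ ^ 2 * S.card ^ 2) + 1)) := by
        gcongr; linarith
    _ ≤ Real.exp (l * (θ * w t).re) *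
          (Fintype.card κ * Real.exp (l ^ 2 / (μ ^ 2 * S.card ^ 2))) := by
        gcongr
        exact Real.add_one_le_exp _
    _ = _ := by ring

end KaczmarzPotential

/-! ### From the iteration to dual certificates and the null space property -/

section DualCertificate

variable {ι κ : Type*} {a : κ → ι → ℂ} {S : Finset ι} {μ : ℝ}

/-- Each step subtracts a multiple of a drawn row, to which `v` is orthogonal. -/
theorem sum_conj_kaczmarz_mul [Fintype ι] {v : ι → ℂ} {N : ℕ} (ω : Fin N → κ)
    (h : ∀ i, ∑ j, starRingEnd ℂ (a (ω i) j) * v j = 0) (w : ι → ℂ) :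
    ∑ j, starRingEnd ℂ (kaczmarz a S μ N ω w j) * v j = ∑ j, starRingEnd ℂ (w j) * v j := by
  induction N generalizing w with
  | zero => rfl
  | succ N ih =>
    rw [kaczmarz, ih (Fin.tail ω) fun i => h i.succ]
    have : ∀ j, starRingEnd ℂ (kaczmarzStep a S μ (ω 0) w j) * v j = starRingEnd ℂ (w j) * v j -
        starRingEnd ℂ (stepSize S μ w * correlation a S (ω 0) w) *
          (starRingEnd ℂ (a (ω 0) j) * v j) := by
      intro j; simp only [kaczmarzStep, map_sub, map_mul]; ring
    simp only [this, Finset.sum_sub_distrib, ← Finset.mul_sum, h, mul_zero, sub_zero]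

/-- A deterministic bound from steps of size at most `1/K`. It suffices for the certificates of
coordinate functionals, because their off-support size is multiplied by the tiny `τ`. -/
theorem norm_kaczmarz_le (ha : ∀ k j, ‖a k j‖ = 1) (hS : S.Nonempty) (hμ : 0 < μ) {K : ℝ}
    (hK : 0 < K) (hKμ : K ^ 2 = μ ^ 2 * S.card) {N : ℕ} (ω : Fin N → κ) (w : ι → ℂ) (t : ι) :
    ‖kaczmarz a S μ N ω w t‖ ≤ ‖w t‖ + N / K := by
  induction N generalizing w with
  | zero => simp [kaczmarz]
  | succ N ih =>
    have h1 : ‖kaczmarzStep a S μ (ω 0) w t‖ ≤ ‖w t‖ + 1 / K := by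
      refine (norm_sub_le _ _).trans ?_
      gcongr
      rw [norm_mul, ha, mul_one, norm_mul, Complex.norm_real]
      apply le_of_sq_le_sq _ (by positivity)
      rw [mul_pow, Real.norm_eq_abs, sq_abs, div_pow, one_pow, hKμ]
      exact stepSize_sq_mul_norm_correlation_sq_le ha hS hμ (ω 0) w
    have h2 := ih (Fin.tail ω) (kaczmarzStep a S μ (ω 0) w)
    calc _ ≤ _ := h2
      _ ≤ ‖w t‖ + 1 / K + N / K := by gcongr
      _ = _ := by push_cast; ring

/-- The potential dominates `T²` and starts at most at `s exp K`; the factor `exp K` is the price of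
the weight. -/
theorem sum_localNorm_kaczmarz_le [Fintype κ] [DecidableEq ι] (ha : ∀ k j, ‖a k j‖ = 1)
    (hortho : ∀ t j, ∑ k, a k t * starRingEnd ℂ (a k j) = if t = j then (Fintype.card κ : ℂ) else 0)
    (hS : S.Nonempty) (hμ : 0 ≤ μ) {K : ℝ} (hK : 0 ≤ K) (hKμ : K ^ 2 = μ ^ 2 * S.card) (N : ℕ)
    {w : ι → ℂ} (hw : localNorm S w ^ 2 ≤ S.card) :
    ∑ ω : Fin N → κ, localNorm S (kaczmarz a S μ N ω w) ^ 2 ≤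
      Fintype.card κ ^ N * (S.card * Real.exp (K - N / (4 * S.card))) := by
  have hs : (1 : ℝ) ≤ S.card := by exact_mod_cast hS.card_pos
  have hq : (0 : ℝ) ≤ 1 - 1 / (4 * S.card) := by
    rw [sub_nonneg, div_le_one (by positivity)]; linarith
  have h1 := sum_kaczmarz_le a S μ
    (F := fun w => localNorm S w ^ 2 * Real.exp (μ * localNorm S w)) (by positivity)
    (sum_potential_kaczmarzStep_le ha hortho hS hμ) N w
  have h2 : μ * localNorm S w ≤ K := by
    apply le_of_sq_le_sq _ hK
    rw [mul_pow, hKμ]; gcongr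
  have h3 : (1 - 1 / (4 * S.card : ℝ)) ^ N ≤ Real.exp (-(N / (4 * S.card))) := by
    calc (1 - 1 / (4 * S.card : ℝ)) ^ N ≤ Real.exp (-(1 / (4 * S.card))) ^ N := by
          gcongr
          linarith [Real.add_one_le_exp (-(1 / (4 * S.card : ℝ)))]
      _ = _ := by rw [← Real.exp_nat_mul]; congr 1; ring
  calc _ ≤ ∑ ω : Fin N → κ, localNorm S (kaczmarz a S μ N ω w) ^ 2 *
        Real.exp (μ * localNorm S (kaczmarz a S μ N ω w)) := by
        refine Finset.sum_le_sum fun ω _ => le_mul_of_one_le_right (sq_nonneg _) ?_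
        exact Real.one_le_exp (mul_nonneg hμ (localNorm_nonneg S _))
    _ ≤ _ := h1
    _ ≤ (Fintype.card κ ^ N * Real.exp (-(N / (4 * S.card)))) * (S.card * Real.exp K) := by
        rw [mul_pow]; gcongr
    _ = _ := by rw [sub_eq_add_neg, Real.exp_add]; ring

theorem sum_exp_kaczmarz_le [Fintype κ] [DecidableEq ι] (ha : ∀ k j, ‖a k j‖ = 1)
    (hortho : ∀ t j, ∑ k, a k t * starRingEnd ℂ (a k j) = if t = j then (Fintype.card κ : ℂ) else 0)
    (hS : S.Nonempty) (hμ : 0 < μ) {K : ℝ} (hK : 0 < K) (hKμ : K ^ 2 = μ ^ 2 * S.card) (N : ℕ)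
    {w : ι → ℂ} {t : ι} (ht : t ∉ S) (hw : w t = 0) {θ : ℂ} (hθ : ‖θ‖ = 1) :
    ∑ ω : Fin N → κ, Real.exp (K / 32 * ((θ * kaczmarz a S μ N ω w t).re - 1 / 4)) ≤
      Fintype.card κ ^ N * Real.exp (N / (1024 * S.card) - K / 128) := by
  have hs : (1 : ℝ) ≤ S.card := by exact_mod_cast hS.card_pos
  have h1 := sum_kaczmarz_le a S μ (F := fun w => Real.exp (K / 32 * (θ * w t).re)) (by positivity)
    (sum_exp_kaczmarzStep_le ha hortho hS hμ ht hθ (l := K / 32)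
      (by rw [← hKμ]; nlinarith [sq_nonneg K])) N w
  have h2 : (K / 32) ^ 2 / (μ ^ 2 * S.card ^ 2) = 1 / (1024 * S.card) := by
    rw [sq (S.card : ℝ), ← mul_assoc, ← hKμ]; field_simp; norm_num
  rw [hw, h2, mul_pow, ← Real.exp_nat_mul] at h1
  simp only [mul_zero, Complex.zero_re, Real.exp_zero, mul_one] at h1
  calc _ = (∑ ω : Fin N → κ, Real.exp (K / 32 * (θ * kaczmarz a S μ N ω w t).re)) *
        Real.exp (-(K / 128)) := by
        rw [Finset.sum_mul]
        refine Finset.sum_congr rfl fun ω _ => ?_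
        rw [← Real.exp_add]; congr 1; ring
    _ ≤ _ := mul_le_mul_of_nonneg_right h1 (Real.exp_pos _).le
    _ = _ := by rw [mul_assoc, ← Real.exp_add]; congr 2; ring

variable [Fintype ι] [DecidableEq ι]

/-- Every nonzero vector annihilated by the measurements indexed by `A` pairs with `σ` strictly
less than its mass off `S`. -/
def NullSpaceProperty (a : κ → ι → ℂ) (S : Finset ι) (σ : ι → ℂ) (A : Finset κ) : Prop :=
  ∀ v : ι → ℂ, (∀ k ∈ A, ∑ j, starRingEnd ℂ (a k j) * v j = 0) → v ≠ 0 →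
    ‖∑ j, starRingEnd ℂ (σ j) * v j‖ < ∑ j ∈ Sᶜ, ‖v j‖

theorem NullSpaceProperty.mono {σ : ι → ℂ} {A B : Finset κ} (h : NullSpaceProperty a S σ A)
    (hAB : A ⊆ B) : NullSpaceProperty a S σ B :=
  fun v hv => h v fun k hk => hv k (hAB hk)

theorem norm_sum_conj_mul_le {w v : ι → ℂ} {β : ℝ} (hβ : ∀ t ∉ S, ‖w t‖ ≤ β) :
    ‖∑ j, starRingEnd ℂ (w j) * v j‖ ≤
      localNorm S w * ∑ j ∈ S, ‖v j‖ + β * ∑ j ∈ Sᶜ, ‖v j‖ := by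
  refine (norm_sum_le _ _).trans ?_
  rw [← Finset.sum_add_sum_compl S, Finset.mul_sum, Finset.mul_sum]
  simp only [norm_mul, RCLike.norm_conj]
  gcongr with j hj j hj
  · exact norm_le_localNorm S w hj
  · exact hβ j (Finset.mem_compl.mp hj)

/-- An approximate dual certificate for `σ`, together with crude ones for the coordinate
functionals on `S`, gives the null space property. -/
theorem nullSpaceProperty_of_certificates {σ : ι → ℂ} {A : Finset κ} {τ B : ℝ} (hτ : 0 ≤ τ)
    (hτS : τ * S.card ≤ 1 / 2) (hτB : 2 * τ * S.card * B ≤ 1 / 4)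
    {u : ι → ℂ} {e : ι → ι → ℂ} (hu : localNorm S u ≤ τ) (he : ∀ j ∈ S, localNorm S (e j) ≤ τ)
    (hu' : ∀ t ∉ S, ‖u t‖ ≤ 1 / 2) (he' : ∀ j ∈ S, ∀ t ∉ S, ‖e j t‖ ≤ B)
    (hpair : ∀ v : ι → ℂ, (∀ k ∈ A, ∑ j, starRingEnd ℂ (a k j) * v j = 0) →
      ∑ j, starRingEnd ℂ (u j) * v j = ∑ j, starRingEnd ℂ (σ j) * v j ∧
      ∀ i ∈ S, ∑ j, starRingEnd ℂ (e i j) * v j = v i) :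
    NullSpaceProperty a S σ A := by
  intro v hv hv0
  obtain ⟨h1, h2⟩ := hpair v hv
  set P := ∑ j ∈ S, ‖v j‖ with hP
  set Q := ∑ j ∈ Sᶜ, ‖v j‖ with hQ
  have hP0 : 0 ≤ P := Finset.sum_nonneg fun _ _ => norm_nonneg _
  have hQ0 : 0 ≤ Q := Finset.sum_nonneg fun _ _ => norm_nonneg _
  have h3 : P ≤ S.card * (τ * P + B * Q) := by
    rw [← nsmul_eq_mul]
    refine Finset.sum_le_card_nsmul _ _ _ fun i hi => ?_
    rw [← h2 i hi]
    exact (norm_sum_conj_mul_le (he' i hi)).trans (by gcongr; exact he i hi)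
  -- Since `τ s ≤ 1/2`, the term in `P` on the right is absorbed.
  have h4 : P ≤ 2 * S.card * B * Q := by nlinarith
  have h5 : 0 < Q := by
    refine hQ0.lt_of_ne fun h0 => hv0 ?_
    have hP1 : P = 0 := le_antisymm (by rw [← h0] at h4; simpa using h4) hP0
    funext j
    by_cases hj : j ∈ S
    · exact norm_eq_zero.mp ((Finset.sum_eq_zero_iff_of_nonneg fun _ _ => norm_nonneg _).mp hP1 j hj)
    · exact norm_eq_zero.mp ((Finset.sum_eq_zero_iff_of_nonneg fun _ _ => norm_nonneg _).mp h0.symm j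
        (Finset.mem_compl.mpr hj))
  rw [← h1]
  calc _ ≤ localNorm S u * P + 1 / 2 * Q := norm_sum_conj_mul_le hu'
    _ ≤ τ * (2 * S.card * B * Q) + 1 / 2 * Q := by gcongr
    _ = (2 * τ * S.card * B) * Q + 1 / 2 * Q := by ring
    _ ≤ 1 / 4 * Q + 1 / 2 * Q := by gcongr
    _ < Q := by linarith

theorem nullSpaceProperty_of_kaczmarz [DecidableEq κ] (ha : ∀ k j, ‖a k j‖ = 1) (hS : S.Nonempty) (hμ : 0 < μ)
    {K : ℝ} (hK : 0 < K) (hKμ : K ^ 2 = μ ^ 2 * S.card) {N : ℕ} (ω : Fin N → κ) {σ : ι → ℂ} {τ : ℝ}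
    (hτ : 0 ≤ τ) (hτS : τ * S.card ≤ 1 / 2) (hτB : 2 * τ * S.card * (N / K) ≤ 1 / 4)
    (hu : localNorm S (kaczmarz a S μ N ω σ) ≤ τ)
    (he : ∀ j ∈ S, localNorm S (kaczmarz a S μ N ω (Pi.single j 1)) ≤ τ)
    (hu' : ∀ t ∉ S, ‖kaczmarz a S μ N ω σ t‖ ≤ 1 / 2) :
    NullSpaceProperty a S σ (Finset.univ.image ω) := by
  refine nullSpaceProperty_of_certificates hτ (B := N / K) hτS hτB hu he hu' ?_ ?_
  · intro j hj t ht
    refine (norm_kaczmarz_le ha hS hμ hK hKμ ω _ t).trans ?_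
    have : t ≠ j := fun h => ht (h ▸ hj)
    simp [this]
  · intro v hv
    have hv' : ∀ i, ∑ j, starRingEnd ℂ (a (ω i) j) * v j = 0 :=
      fun i => hv _ (Finset.mem_image_of_mem ω (Finset.mem_univ i))
    refine ⟨sum_conj_kaczmarz_mul ω hv' σ, fun i _ => ?_⟩
    rw [sum_conj_kaczmarz_mul ω hv' _, Finset.sum_eq_single i]
    · simp
    · intro j _ hj; simp [hj]
    · simp

/-- The four directions `±1`, `±i`. -/
noncomputable def axisDirections : Finset ℂ := {1, -1, Complex.I, -Complex.I}

theorem norm_of_mem_axisDirections {θ : ℂ} (hθ : θ ∈ axisDirections) : ‖θ‖ = 1 := by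
  simp only [axisDirections, Finset.mem_insert, Finset.mem_singleton] at hθ
  rcases hθ with h | h | h | h <;> simp [h]

theorem card_axisDirections_le : (axisDirections.card : ℝ) ≤ 4 := by
  exact_mod_cast Finset.card_le_four

theorem norm_le_half_of_sum_exp_lt_one {l : ℝ} (hl : 0 ≤ l) {z : ℂ}
    (h : ∑ θ ∈ axisDirections, Real.exp (l * ((θ * z).re - 1 / 4)) < 1) : ‖z‖ ≤ 1 / 2 := by
  have key : ∀ θ ∈ axisDirections, (θ * z).re < 1 / 4 := by
    intro θ hθ
    have h1 := (Finset.single_le_sum (f := fun θ => Real.exp (l * ((θ * z).re - 1 / 4)))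
      (fun _ _ => (Real.exp_pos _).le) hθ).trans_lt h
    by_contra! h2
    exact absurd h1 (not_lt.mpr (Real.one_le_exp (mul_nonneg hl (by linarith))))
  have h1 := key 1 (by simp [axisDirections])
  have h2 := key (-1) (by simp [axisDirections])
  have h3 := key Complex.I (by simp [axisDirections])
  have h4 := key (-Complex.I) (by simp [axisDirections])
  simp at h1 h2 h3 h4
  have h5 : |z.re| ≤ 1 / 4 := abs_le.mpr ⟨by linarith, by linarith⟩
  have h6 : |z.im| ≤ 1 / 4 := abs_le.mpr ⟨by linarith, by linarith⟩
  linarith [Complex.norm_le_abs_re_add_abs_im z]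

open Classical in
/-- The number of index sequences for which the null space property fails. -/
theorem card_not_nullSpaceProperty_le [Fintype κ] [DecidableEq κ] (ha : ∀ k j, ‖a k j‖ = 1)
    (hortho : ∀ t j, ∑ k, a k t * starRingEnd ℂ (a k j) = if t = j then (Fintype.card κ : ℂ) else 0)
    (hS : S.Nonempty) {σ : ι → ℂ} (hσ : ∀ j ∈ S, ‖σ j‖ ≤ 1) (hσ' : ∀ j ∉ S, σ j = 0) {K : ℝ}
    (hK : 0 < K) (N : ℕ) {τ : ℝ} (hτ : 0 < τ) (hτS : τ * S.card ≤ 1 / 2)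
    (hτB : 2 * τ * S.card * (N / K) ≤ 1 / 4) :
    ((Finset.univ.filter fun ω : Fin N → κ =>
        ¬ NullSpaceProperty a S σ (Finset.univ.image ω)).card : ℝ) ≤
      Fintype.card κ ^ N * ((S.card + 1) * S.card / τ ^ 2 * Real.exp (K - N / (4 * S.card)) +
        4 * Fintype.card ι * Real.exp (N / (1024 * S.card) - K / 128)) := by
  have hs : (1 : ℝ) ≤ S.card := by exact_mod_cast hS.card_pos
  -- This scaling makes `μT ≤ K` for the starting vectors, whose residual norm is at most `√s`.
  set μ := K / Real.sqrt S.card with hμdef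
  have hμ : 0 < μ := by positivity
  have hKμ : K ^ 2 = μ ^ 2 * S.card := by
    rw [hμdef, div_pow, Real.sq_sqrt (by positivity)]; field_simp
  -- Markov's inequality and union bound at once: `G` is nonnegative and at least 1 at every
  -- failure, so its sum bounds the number of failures.
  set G : (Fin N → κ) → ℝ := fun ω =>
    (localNorm S (kaczmarz a S μ N ω σ) ^ 2 +
        ∑ j ∈ S, localNorm S (kaczmarz a S μ N ω (Pi.single j 1)) ^ 2) / τ ^ 2 +
      ∑ t ∈ Sᶜ, ∑ θ ∈ axisDirections, Real.exp (K / 32 * ((θ * kaczmarz a S μ N ω σ t).re - 1 / 4)) with hG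
  have hG0 : ∀ ω, 0 ≤ G ω := fun ω => by positivity
  have hbad : ∀ ω, ¬ NullSpaceProperty a S σ (Finset.univ.image ω) → 1 ≤ G ω := by
    intro ω hω
    by_contra! hlt
    apply hω
    have hA : 0 ≤ localNorm S (kaczmarz a S μ N ω σ) ^ 2 := sq_nonneg _
    have hB : 0 ≤ ∑ j ∈ S, localNorm S (kaczmarz a S μ N ω (Pi.single j 1)) ^ 2 :=
      Finset.sum_nonneg fun _ _ => sq_nonneg _
    have hC : 0 ≤ ∑ t ∈ Sᶜ, ∑ θ ∈ axisDirections,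
        Real.exp (K / 32 * ((θ * kaczmarz a S μ N ω σ t).re - 1 / 4)) :=
      Finset.sum_nonneg fun _ _ => Finset.sum_nonneg fun _ _ => (Real.exp_pos _).le
    have hAB : localNorm S (kaczmarz a S μ N ω σ) ^ 2 +
        ∑ j ∈ S, localNorm S (kaczmarz a S μ N ω (Pi.single j 1)) ^ 2 < τ ^ 2 := by
      rw [← div_lt_one (by positivity)]; simp only [hG] at hlt; linarith
    refine nullSpaceProperty_of_kaczmarz ha hS hμ hK hKμ ω hτ.le hτS hτB ?_ ?_ ?_
    · exact le_of_sq_le_sq (by linarith) hτ.le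
    · intro j hj
      apply le_of_sq_le_sq _ hτ.le
      have := Finset.single_le_sum
        (f := fun j => localNorm S (kaczmarz a S μ N ω (Pi.single j 1)) ^ 2)
        (fun _ _ => sq_nonneg _) hj
      linarith
    · intro t ht
      apply norm_le_half_of_sum_exp_lt_one (l := K / 32) (by positivity)
      have h7 := Finset.single_le_sum (f := fun t => ∑ θ ∈ axisDirections,
          Real.exp (K / 32 * ((θ * kaczmarz a S μ N ω σ t).re - 1 / 4)))
        (fun _ _ => Finset.sum_nonneg fun _ _ => (Real.exp_pos _).le) (Finset.mem_compl.mpr ht)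
      have h8 := div_nonneg (add_nonneg hA hB) (sq_nonneg τ)
      simp only [hG] at hlt
      linarith
  have hcount : ((Finset.univ.filter fun ω : Fin N → κ =>
      ¬ NullSpaceProperty a S σ (Finset.univ.image ω)).card : ℝ) ≤ ∑ ω, G ω := by
    rw [Finset.card_eq_sum_ones, Nat.cast_sum]
    calc _ ≤ ∑ ω ∈ Finset.univ.filter fun ω : Fin N → κ =>
            ¬ NullSpaceProperty a S σ (Finset.univ.image ω), G ω := by
          refine Finset.sum_le_sum fun ω hω => ?_
          rw [Nat.cast_one]; exact hbad ω (Finset.mem_filter.mp hω).2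
      _ ≤ _ := Finset.sum_le_univ_sum_of_nonneg hG0
  have hσS : localNorm S σ ^ 2 ≤ S.card := by
    rw [localNorm_sq, ← mul_one (S.card : ℝ), ← nsmul_eq_mul]
    exact Finset.sum_le_card_nsmul _ _ _ fun j hj => pow_le_one₀ (norm_nonneg _) (hσ j hj)
  have hsingle : ∀ j ∈ S, localNorm S (Pi.single j (1 : ℂ) : ι → ℂ) ^ 2 ≤ S.card := by
    intro j _
    rw [localNorm_sq, ← mul_one (S.card : ℝ), ← nsmul_eq_mul]
    refine Finset.sum_le_card_nsmul _ _ _ fun i _ => pow_le_one₀ (norm_nonneg _) ?_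
    by_cases hi : i = j
    · subst hi; simp
    · simp [hi]
  refine hcount.trans ?_
  simp only [hG]
  rw [Finset.sum_add_distrib, ← Finset.sum_div, Finset.sum_add_distrib, Finset.sum_comm,
    Finset.sum_comm (s := Finset.univ) (t := Sᶜ)]
  set E₁ := Real.exp (K - N / (4 * S.card)) with hE₁
  set E₂ := Real.exp (N / (1024 * S.card) - K / 128) with hE₂
  have hfirst : ∑ ω : Fin N → κ, localNorm S (kaczmarz a S μ N ω σ) ^ 2 ≤
      Fintype.card κ ^ N * (S.card * E₁) :=
    sum_localNorm_kaczmarz_le ha hortho hS hμ.le hK.le hKμ N hσS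
  have hsecond : ∑ j ∈ S, ∑ ω : Fin N → κ, localNorm S (kaczmarz a S μ N ω (Pi.single j 1)) ^ 2 ≤
      S.card * (Fintype.card κ ^ N * (S.card * E₁)) := by
    rw [← nsmul_eq_mul]
    exact Finset.sum_le_card_nsmul _ _ _ fun j hj =>
      sum_localNorm_kaczmarz_le ha hortho hS hμ.le hK.le hKμ N (hsingle j hj)
  have hthird : ∑ t ∈ Sᶜ, ∑ ω : Fin N → κ, ∑ θ ∈ axisDirections,
        Real.exp (K / 32 * ((θ * kaczmarz a S μ N ω σ t).re - 1 / 4)) ≤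
      Fintype.card ι * (4 * (Fintype.card κ ^ N * E₂)) := by
    calc _ ≤ ∑ t ∈ Sᶜ, 4 * (Fintype.card κ ^ N * E₂) := by
          refine Finset.sum_le_sum fun t ht => ?_
          rw [Finset.sum_comm]
          have ht' := Finset.mem_compl.mp ht
          calc _ ≤ ∑ θ ∈ axisDirections, Fintype.card κ ^ N * E₂ := Finset.sum_le_sum fun θ hθ =>
                sum_exp_kaczmarz_le ha hortho hS hμ hK hKμ N ht' (hσ' t ht') (norm_of_mem_axisDirections hθ)
            _ = axisDirections.card * (Fintype.card κ ^ N * E₂) := by rw [Finset.sum_const, nsmul_eq_mul]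
            _ ≤ _ := by gcongr; exact card_axisDirections_le
      _ = (Sᶜ.card : ℝ) * (4 * (Fintype.card κ ^ N * E₂)) := by
          rw [Finset.sum_const, nsmul_eq_mul]
      _ ≤ _ := by gcongr; exact Finset.card_le_univ _
  calc _ ≤ (Fintype.card κ ^ N * (S.card * E₁) + S.card * (Fintype.card κ ^ N * (S.card * E₁))) /
        τ ^ 2 + Fintype.card ι * (4 * (Fintype.card κ ^ N * E₂)) := by
        gcongr
    _ = _ := by ring

end DualCertificate

/-! ### Choice of the constants -/

section NumericalChoice

variable {ι κ : Type*} {a : κ → ι → ℂ} {S : Finset ι} [Fintype ι] [DecidableEq ι] [Fintype κ]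
  [DecidableEq κ]

open Classical in
/-- For an explicit number of draws of order `s log n`, at least half of the index sequences have
the null space property. -/
theorem card_not_nullSpaceProperty_le_half (ha : ∀ k j, ‖a k j‖ = 1)
    (hortho : ∀ t j, ∑ k, a k t * starRingEnd ℂ (a k j) = if t = j then (Fintype.card κ : ℂ) else 0)
    (hι : 2 ≤ Fintype.card ι) (hS : S.Nonempty) {σ : ι → ℂ} (hσ : ∀ j ∈ S, ‖σ j‖ ≤ 1)
    (hσ' : ∀ j ∉ S, σ j = 0) {N : ℕ} (hN : 5688 * S.card * Real.log (Fintype.card ι) ≤ N)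
    (hN' : (N : ℝ) ≤ 5692 * S.card * Real.log (Fintype.card ι)) :
    ((Finset.univ.filter fun ω : Fin N → κ =>
        ¬ NullSpaceProperty a S σ (Finset.univ.image ω)).card : ℝ) ≤
      Fintype.card κ ^ N * (1 / 2) := by
  have hs : (1 : ℝ) ≤ S.card := by exact_mod_cast hS.card_pos
  have hn2 : (2 : ℝ) ≤ Fintype.card ι := by exact_mod_cast hι
  have hsn : (S.card : ℝ) ≤ Fintype.card ι := by exact_mod_cast Finset.card_le_univ S
  set n : ℝ := (Fintype.card ι : ℝ) with hn
  set s : ℝ := (S.card : ℝ) with hsdef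
  have hs0 : 0 < s := by linarith
  have hn0 : 0 < n := by linarith
  set L := Real.log n with hL
  have hL0 : 0 < L := Real.log_pos (by linarith)
  have hexp : ∀ k : ℕ, Real.exp (-(k * L)) = (n ^ k)⁻¹ := by
    intro k
    rw [Real.exp_neg, Real.exp_nat_mul, Real.exp_log hn0]
  have hB : (N : ℝ) / (1400 * L) ≤ 5 * s := by
    rw [div_le_iff₀ (by positivity)]
    nlinarith [mul_pos hs0 hL0]
  have hss : s * s ≤ n ^ 2 := by nlinarith
  -- The constants satisfy `5688/4 - 1400 = 22` and `1400/128 - 5692/1024 > 5`, so the two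
  -- exponentials are at most `n^(-22)` and `n^(-5)`; these beat the prefactors, at most `3200 n^6`
  -- and `4n`.
  refine (card_not_nullSpaceProperty_le ha hortho hS hσ hσ' (K := 1400 * L) (by positivity) N
    (τ := 1 / (40 * n ^ 2)) (by positivity) ?_ ?_).trans ?_
  · rw [div_mul_eq_mul_div, one_mul, div_le_div_iff₀ (by positivity) (by norm_num)]
    nlinarith
  · calc 2 * (1 / (40 * n ^ 2)) * s * (N / (1400 * L)) ≤ 2 * (1 / (40 * n ^ 2)) * s * (5 * s) := by
          gcongr
      _ = (s * s) / (4 * n ^ 2) := by field_simp; norm_num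
      _ ≤ n ^ 2 / (4 * n ^ 2) := by gcongr
      _ = 1 / 4 := by field_simp
  · gcongr
    rw [← hsdef, ← hn]
    have h1 : Real.exp (1400 * L - N / (4 * s)) ≤ (n ^ 22)⁻¹ := by
      rw [← hexp]
      apply Real.exp_le_exp.mpr
      have : 1422 * L ≤ N / (4 * s) := by
        rw [le_div_iff₀ (by positivity)]; linarith
      push_cast; linarith
    have h2 : Real.exp (N / (1024 * s) - 1400 * L / 128) ≤ (n ^ 5)⁻¹ := by
      rw [← hexp]
      apply Real.exp_le_exp.mpr
      have : N / (1024 * s) ≤ 5692 / 1024 * L := by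
        rw [div_le_iff₀ (by positivity)]; nlinarith
      push_cast; linarith
    have h3 : (s + 1) * s / (1 / (40 * n ^ 2)) ^ 2 ≤ 3200 * n ^ 6 := by
      have : (s + 1) * s / (1 / (40 * n ^ 2)) ^ 2 = 1600 * ((s + 1) * s) * n ^ 4 := by
        field_simp; norm_num
      have hs2 : (s + 1) * s ≤ 2 * n ^ 2 := by nlinarith
      rw [this]
      calc 1600 * ((s + 1) * s) * n ^ 4 ≤ 1600 * (2 * n ^ 2) * n ^ 4 := by gcongr
        _ = _ := by ring
    have h4 : (2 : ℝ) ^ 16 ≤ n ^ 16 := by gcongr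
    have h5 : (2 : ℝ) ^ 4 ≤ n ^ 4 := by gcongr
    calc _ ≤ 3200 * n ^ 6 * (n ^ 22)⁻¹ + 4 * n * (n ^ 5)⁻¹ := by gcongr
      _ = 3200 / n ^ 16 + 4 / n ^ 4 := by field_simp
      _ ≤ 3200 / 2 ^ 16 + 4 / 2 ^ 4 := by gcongr
      _ ≤ 1 / 2 := by norm_num

end NumericalChoice

/-! ### Counting draws: independent blocks and sampling without replacement -/

section Draws

variable {κ : Type*} [Fintype κ] [DecidableEq κ] {Q : Finset κ → Prop} [DecidablePred Q]

/-- The number of sequences of `m` draws whose set of values satisfies `Q`. -/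
def drawCount (Q : Finset κ → Prop) [DecidablePred Q] (m : ℕ) : ℕ :=
  (Finset.univ.filter fun ω : Fin m → κ => Q (Finset.univ.image ω)).card

theorem drawCount_le (m : ℕ) : drawCount Q m ≤ Fintype.card κ ^ m := by
  refine (Finset.card_le_univ _).trans (by simp)

/-- If all values together are bad, so are those of each block; splitting into two blocks is
injective. -/
theorem drawCount_add_le (hQ : ∀ A B, A ⊆ B → Q B → Q A) (p q : ℕ) :
    drawCount Q (p + q) ≤ drawCount Q p * drawCount Q q := by
  unfold drawCount
  rw [← Finset.card_product]
  refine Finset.card_le_card_of_injOn (fun ω => (fun i => ω (Fin.castAdd q i),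
    fun i => ω (Fin.natAdd p i))) ?_ ?_
  · intro ω hω
    have hω' := (Finset.mem_filter.mp hω).2
    simp only [Finset.coe_product, Set.mem_prod, Finset.coe_filter, Finset.mem_univ, true_and,
      Set.mem_ofPred_eq]
    refine ⟨hQ _ _ ?_ hω', hQ _ _ ?_ hω'⟩ <;>
    · intro x hx
      simp only [Finset.mem_image, Finset.mem_univ, true_and] at hx ⊢
      obtain ⟨i, rfl⟩ := hx
      exact ⟨_, rfl⟩
  · intro ω _ ω' _ h
    simp only [Prod.mk.injEq] at h
    funext i
    refine Fin.addCases (fun i => ?_) (fun i => ?_) i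
    · exact congrFun h.1 i
    · exact congrFun h.2 i

theorem drawCount_mul_add_le (hQ : ∀ A B, A ⊆ B → Q B → Q A) (N b r : ℕ) :
    drawCount Q (N * b + r) ≤ drawCount Q N ^ b * Fintype.card κ ^ r := by
  induction b with
  | zero => simpa using drawCount_le (Q := Q) r
  | succ b ih =>
    rw [show N * (b + 1) + r = N + (N * b + r) by ring]
    calc _ ≤ drawCount Q N * (drawCount Q N ^ b * Fintype.card κ ^ r) :=
          (drawCount_add_le hQ _ _).trans (Nat.mul_le_mul_left _ ih)
      _ = _ := by ring

/-- Repeating an experiment with failure probability at most one half. -/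
theorem drawCount_le_half_pow (hQ : ∀ A B, A ⊆ B → Q B → Q A) {N b m : ℕ}
    (hN : (drawCount Q N : ℝ) ≤ Fintype.card κ ^ N * (1 / 2)) (hm : N * b ≤ m) :
    (drawCount Q m : ℝ) ≤ Fintype.card κ ^ m * (1 / 2) ^ b := by
  obtain ⟨r, rfl⟩ := Nat.exists_eq_add_of_le hm
  calc (drawCount Q (N * b + r) : ℝ) ≤ (drawCount Q N : ℝ) ^ b * (Fintype.card κ : ℝ) ^ r := by
        exact_mod_cast drawCount_mul_add_le hQ N b r
    _ ≤ (Fintype.card κ ^ N * (1 / 2)) ^ b * (Fintype.card κ : ℝ) ^ r := by gcongr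
    _ = _ := by rw [mul_pow, pow_add, pow_mul]; ring

/-- The number of permutations moving `T` to a set satisfying `Q` depends only on `T.card`. -/
theorem card_perm_map_eq {T T' : Finset κ} (h : T.card = T'.card) :
    (Finset.univ.filter fun π : Equiv.Perm κ => Q (T.map π.toEmbedding)).card =
      (Finset.univ.filter fun π : Equiv.Perm κ => Q (T'.map π.toEmbedding)).card := by
  obtain ⟨ρ, hρ⟩ : ∃ ρ : Equiv.Perm κ, T.map ρ.toEmbedding = T' := by
    let e : {x // x ∈ T} ≃ {x // x ∈ T'} := Finset.equivOfCardEq h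
    refine ⟨e.extendSubtype, ?_⟩
    apply Finset.eq_of_subset_of_card_le
    · intro x hx
      obtain ⟨y, hy, rfl⟩ := Finset.mem_map.mp hx
      exact e.extendSubtype_mem y hy
    · rw [Finset.card_map, h]
  subst hρ
  symm
  refine Finset.card_bij (fun π _ => ρ.trans π) ?_ ?_ ?_
  · intro π hπ
    simpa [Finset.map_map] using hπ
  · intro π _ π' _ h
    ext x
    have := congrArg (fun f : Equiv.Perm κ => f (ρ.symm x)) h
    simpa using this
  · intro π hπ
    refine ⟨ρ.symm.trans π, ?_, ?_⟩
    · have : (ρ.toEmbedding.trans (ρ.symm.trans π).toEmbedding) = π.toEmbedding := by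
        ext x; simp
      simpa only [Finset.mem_filter, Finset.mem_univ, true_and, Finset.map_map, this] using hπ
    · ext x; simp

/-- For a property inherited by subsets, `m`-element subsets are less likely to satisfy it than
sets of values of `m` draws. -/
theorem card_powersetCard_filter_mul_le (hQ : ∀ A B, A ⊆ B → Q B → Q A) {m : ℕ}
    (hm : m ≤ Fintype.card κ) :
    ((Finset.powersetCard m (Finset.univ : Finset κ)).filter Q).card * Fintype.card κ ^ m ≤
      (Fintype.card κ).choose m * drawCount Q m := by
  obtain ⟨T₀, -, hT₀⟩ := Finset.exists_subset_card_eq (s := (Finset.univ : Finset κ)) hm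
  set A := (Finset.univ.filter fun π : Equiv.Perm κ => Q (T₀.map π.toEmbedding)).card with hA
  -- Enlarge the values of `ω` to an `m`-set `T`. If a permutation makes `T` bad, it makes the
  -- smaller set of values bad too. Then double count pairs of sequence and permutation.
  have h1 : Fintype.card κ ^ m * A ≤ Fintype.card (Equiv.Perm κ) * drawCount Q m := by
    calc Fintype.card κ ^ m * A = ∑ _ω : Fin m → κ, A := by simp
      _ ≤ ∑ ω : Fin m → κ, (Finset.univ.filter fun π : Equiv.Perm κ =>
            Q (Finset.univ.image (π ∘ ω))).card := by
          refine Finset.sum_le_sum fun ω _ => ?_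
          obtain ⟨T, hT, -, hTc⟩ := Finset.exists_subsuperset_card_eq
            (Finset.subset_univ (Finset.univ.image ω))
            (Finset.card_image_le.trans (by simp) : _ ≤ m) hm
          rw [hA, card_perm_map_eq (hT₀.trans hTc.symm)]
          refine Finset.card_le_card fun π hπ => ?_
          simp only [Finset.mem_filter, Finset.mem_univ, true_and] at hπ ⊢
          refine hQ _ _ ?_ hπ
          intro x hx
          obtain ⟨i, -, rfl⟩ := Finset.mem_image.mp hx
          exact Finset.mem_map_of_mem π.toEmbedding
            (hT (Finset.mem_image_of_mem ω (Finset.mem_univ i)))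
      _ = ∑ π : Equiv.Perm κ, (Finset.univ.filter fun ω : Fin m → κ =>
            Q (Finset.univ.image (π ∘ ω))).card := by
          simp only [Finset.card_filter]; exact Finset.sum_comm
      _ = ∑ _π : Equiv.Perm κ, drawCount Q m := by
          refine Finset.sum_congr rfl fun π _ => ?_
          unfold drawCount
          exact Finset.card_equiv (Equiv.arrowCongr (Equiv.refl _) π) fun ω => by
            simp [Equiv.arrowCongr]
      _ = _ := by simp
  have h2 : (Fintype.card κ).choose m * A = Fintype.card (Equiv.Perm κ) *
      ((Finset.powersetCard m (Finset.univ : Finset κ)).filter Q).card := by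
    calc (Fintype.card κ).choose m * A = ∑ _T ∈ Finset.powersetCard m (Finset.univ : Finset κ), A := by
          simp
      _ = ∑ T ∈ Finset.powersetCard m (Finset.univ : Finset κ),
            (Finset.univ.filter fun π : Equiv.Perm κ => Q (T.map π.toEmbedding)).card :=
          Finset.sum_congr rfl fun T hT =>
            card_perm_map_eq (hT₀.trans (Finset.mem_powersetCard.mp hT).2.symm)
      _ = ∑ π : Equiv.Perm κ, ((Finset.powersetCard m (Finset.univ : Finset κ)).filter fun T =>
            Q (T.map π.toEmbedding)).card := by
          simp only [Finset.card_filter]; exact Finset.sum_comm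
      _ = ∑ _π : Equiv.Perm κ, ((Finset.powersetCard m (Finset.univ : Finset κ)).filter Q).card := by
          refine Finset.sum_congr rfl fun π _ => ?_
          exact Finset.card_equiv π.finsetCongr fun T => by simp [Finset.mem_powersetCard]
      _ = _ := by simp
  have hpos : 0 < Fintype.card (Equiv.Perm κ) := Fintype.card_pos
  refine Nat.le_of_mul_le_mul_left ?_ hpos
  calc _ = Fintype.card κ ^ m * (Fintype.card (Equiv.Perm κ) *
        ((Finset.powersetCard m (Finset.univ : Finset κ)).filter Q).card) := by ring
    _ = (Fintype.card κ).choose m * (Fintype.card κ ^ m * A) := by rw [← h2]; ring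
    _ ≤ (Fintype.card κ).choose m * (Fintype.card (Equiv.Perm κ) * drawCount Q m) :=
        Nat.mul_le_mul_left _ h1
    _ = _ := by ring

end Draws

/-! ### Orthogonality of the Fourier characters -/

section Fourier

/-- The Fourier character of frequency `k` on `Fin n`. -/
noncomputable def fourierVec (n : ℕ) (k : ℤ) (j : Fin n) : ℂ :=
  Complex.exp (2 * Real.pi * Complex.I * k * (j : ℕ) / n)

theorem norm_fourierVec (n : ℕ) (k : ℤ) (j : Fin n) : ‖fourierVec n k j‖ = 1 := by
  have : (2 * Real.pi * Complex.I * k * (j : ℕ) / n : ℂ) =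
      ((2 * Real.pi * k * (j : ℕ) / n : ℝ) : ℂ) * Complex.I := by push_cast; ring
  rw [fourierVec, this, Complex.norm_exp_ofReal_mul_I]

theorem conj_fourierVec (n : ℕ) (k : ℤ) (j : Fin n) :
    starRingEnd ℂ (fourierVec n k j) =
      Complex.exp (-2 * Real.pi * Complex.I * k * (j : ℕ) / n) := by
  rw [fourierVec, ← Complex.exp_conj]
  congr 1
  simp only [map_div₀, map_mul, Complex.conj_I, Complex.conj_ofReal, map_ofNat, map_intCast,
    map_natCast]
  ring

theorem dft_eq_zero_iff {n : ℕ} (hn : n ≠ 0) (z : Fin n → ℂ) (k : ℤ) :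
    dft n z k = 0 ↔ ∑ j, starRingEnd ℂ (fourierVec n k j) * z j = 0 := by
  have h : (1 / (Real.sqrt n : ℂ)) ≠ 0 := by
    simp only [ne_eq, div_eq_zero_iff, one_ne_zero, false_or, Complex.ofReal_eq_zero]
    exact (Real.sqrt_ne_zero (Nat.cast_nonneg n)).mpr (by exact_mod_cast hn)
  rw [dft, mul_eq_zero, or_iff_right h]
  simp only [conj_fourierVec, mul_comm]

theorem card_freqs {n : ℕ} (hn : Even n) : (freqs n).card = n := by
  obtain ⟨p, rfl⟩ := hn
  rw [freqs, Int.card_Icc]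
  omega

theorem sum_freqs_pow {n : ℕ} (hn : Even n) {z : ℂ} (hz0 : z ≠ 0) (hz : z ^ n = 1) (hz1 : z ≠ 1) :
    ∑ k ∈ freqs n, z ^ k = 0 := by
  have h : ∑ k ∈ freqs n, z ^ k = ∑ i ∈ Finset.range n, z ^ (-((n : ℤ) / 2) + 1) * z ^ i := by
    symm
    refine Finset.sum_bij (fun i _ => -((n : ℤ) / 2) + 1 + i) ?_ ?_ ?_ ?_
    · intro i hi
      obtain ⟨p, rfl⟩ := hn
      simp only [freqs, Finset.mem_Icc, Finset.mem_range] at hi ⊢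
      omega
    · intro i _ j _ h; omega
    · intro k hk
      obtain ⟨p, rfl⟩ := hn
      simp only [freqs, Finset.mem_Icc] at hk
      exact ⟨(k + ((p + p : ℕ) : ℤ) / 2 - 1).toNat, by simp only [Finset.mem_range]; omega, by omega⟩
    · intro i _; rw [zpow_add₀ hz0 _ (i : ℤ), zpow_natCast]
  rw [h, ← Finset.mul_sum, geom_sum_eq hz1, hz]
  simp

theorem sum_fourierVec_mul_conj {n : ℕ} (hn : Even n) (t j : Fin n) :
    ∑ k : {k // k ∈ freqs n}, fourierVec n k t * starRingEnd ℂ (fourierVec n k j) =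
      if t = j then (Fintype.card {k // k ∈ freqs n} : ℂ) else 0 := by
  have hn0 : (n : ℂ) ≠ 0 := by exact_mod_cast (Fin.pos t).ne'
  split_ifs with h
  · subst h
    have : ∀ k : {k // k ∈ freqs n},
        fourierVec n k t * starRingEnd ℂ (fourierVec n k t) = 1 := by
      intro k
      rw [Complex.mul_conj, Complex.normSq_eq_norm_sq, norm_fourierVec]; simp
    simp [this]
  · set θ : ℂ := 2 * Real.pi * Complex.I * (((t : ℕ) : ℂ) - ((j : ℕ) : ℂ)) / n with hθ
    have hterm : ∀ k : ℤ, fourierVec n k t * starRingEnd ℂ (fourierVec n k j) =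
        Complex.exp θ ^ k := by
      intro k
      rw [conj_fourierVec, fourierVec, ← Complex.exp_add, ← Complex.exp_int_mul, hθ]
      congr 1; ring
    simp only [hterm]
    rw [Finset.sum_coe_sort (freqs n) fun k => Complex.exp θ ^ k]
    apply sum_freqs_pow hn (Complex.exp_ne_zero _)
    · rw [← Complex.exp_nat_mul, Complex.exp_eq_one_iff]
      refine ⟨(t : ℤ) - (j : ℤ), ?_⟩
      rw [hθ]; push_cast; field_simp
    · rw [Ne, Complex.exp_eq_one_iff]
      rintro ⟨q, hq⟩
      apply h
      have h1 : (((t : ℕ) : ℂ) - ((j : ℕ) : ℂ)) = q * n := by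
        have h2πI : (2 * Real.pi * Complex.I : ℂ) ≠ 0 := Complex.two_pi_I_ne_zero
        apply mul_left_cancel₀ h2πI
        rw [hθ, div_eq_iff hn0] at hq
        rw [hq]; ring
      have h2 : ((t : ℕ) : ℤ) - ((j : ℕ) : ℤ) = q * n := by exact_mod_cast h1
      have ht := t.isLt
      have hj := j.isLt
      -- `t - j` is a multiple of `n` with absolute value below `n`.
      have h3 : q = 0 := by
        by_contra hq0
        rcases lt_or_gt_of_ne hq0 with hlt | hgt
        · have : q * (n : ℤ) ≤ -1 * n := by gcongr; omega
          omega
        · have : 1 * (n : ℤ) ≤ q * n := by gcongr; omega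
          omega
      rw [h3] at h2
      exact Fin.ext (by omega)

end Fourier

/-! ### The periodic gradient in the Fourier domain -/

section Gradient

variable {n : ℕ}

/-- The cyclic predecessor on `Fin n`. -/
def cyclicPred (j : Fin n) : Fin n := ⟨((j : ℕ) + (n - 1)) % n, Nat.mod_lt _ j.pos⟩

theorem cyclicPred_val_of_pos {j : Fin n} (hj : 0 < (j : ℕ)) : (cyclicPred j : ℕ) = j - 1 := by
  have := j.isLt
  simp only [cyclicPred]
  rw [show (j : ℕ) + (n - 1) = (j - 1) + n by omega, Nat.add_mod_right, Nat.mod_eq_of_lt (by omega)]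

theorem cyclicPred_injective : Function.Injective (cyclicPred (n := n)) := by
  intro i j h
  have hi := i.isLt
  have hj := j.isLt
  have h' : (i : ℕ) + (n - 1) ≡ (j : ℕ) + (n - 1) [MOD n] := congrArg Fin.val h
  have h2 := Nat.ModEq.add_right_cancel' _ h'
  rw [Nat.ModEq, Nat.mod_eq_of_lt hi, Nat.mod_eq_of_lt hj] at h2
  exact Fin.ext h2

theorem cyclicPred_bijective : Function.Bijective (cyclicPred (n := n)) :=
  Finite.injective_iff_bijective.mp cyclicPred_injective

theorem grad_eq (z : Fin n → ℂ) (j : Fin n) : grad z j = z j - z (cyclicPred j) := rfl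

theorem grad_sub (z x : Fin n → ℂ) : grad (z - x) = grad z - grad x := by
  funext j
  simp only [grad_eq, Pi.sub_apply]
  ring

theorem eq_of_grad_eq_zero {z : Fin n → ℂ} (h : grad z = 0) (i j : Fin n) : z i = z j := by
  have key : ∀ (p : ℕ) (hp : p < n), z ⟨p, hp⟩ = z ⟨0, by omega⟩ := by
    intro p
    induction p with
    | zero => intro _; rfl
    | succ p ih =>
      intro hp
      rw [← ih (by omega)]
      have h1 := congrFun h ⟨p + 1, hp⟩
      rw [grad_eq, Pi.zero_apply, sub_eq_zero] at h1
      rw [h1]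
      congr 1
      exact Fin.ext (by rw [cyclicPred_val_of_pos (by simp)]; simp)
  rw [key i i.isLt, key j j.isLt]

theorem conj_fourierVec_cyclicPred (k : ℤ) (j : Fin n) :
    starRingEnd ℂ (fourierVec n k j) =
      Complex.exp (-2 * Real.pi * Complex.I * k / n) *
        starRingEnd ℂ (fourierVec n k (cyclicPred j)) := by
  have hn0 : (n : ℂ) ≠ 0 := by exact_mod_cast (Fin.pos j).ne'
  rw [conj_fourierVec, conj_fourierVec, ← Complex.exp_add, Complex.exp_eq_exp_iff_exists_int]
  have hmod := Nat.div_add_mod ((j : ℕ) + (n - 1)) n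
  have hpos := Fin.pos j
  set d := ((j : ℕ) + (n - 1)) / n
  have h1 : ((cyclicPred j : Fin n) : ℤ) = j + n - 1 - n * d := by
    simp only [cyclicPred]
    zify [hpos] at hmod ⊢
    linarith
  have h2 : (((cyclicPred j : Fin n) : ℕ) : ℂ) = (j : ℕ) + n - 1 - n * d := by exact_mod_cast h1
  -- `d` is 0 at the wrap-around `j = 0` and 1 otherwise, so the exponents differ by a full period
  -- only at the wrap-around.
  refine ⟨k * (1 - d), ?_⟩
  rw [h2]
  push_cast
  field_simp
  ring

/-- Summation by parts on the cycle: characters are eigenvectors of the shift. -/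
theorem sum_conj_fourierVec_mul_grad (z : Fin n → ℂ) (k : ℤ) :
    ∑ j, starRingEnd ℂ (fourierVec n k j) * grad z j =
      (1 - Complex.exp (-2 * Real.pi * Complex.I * k / n)) *
        ∑ j, starRingEnd ℂ (fourierVec n k j) * z j := by
  simp only [grad_eq, mul_sub, Finset.sum_sub_distrib, sub_mul, one_mul]
  congr 1
  rw [← cyclicPred_bijective.sum_comp (fun j => starRingEnd ℂ (fourierVec n k j) * z j),
    Finset.mul_sum]
  exact Finset.sum_congr rfl fun j _ => by rw [conj_fourierVec_cyclicPred]; ring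

end Gradient

/-! ### Null space property implies recovery -/

section Recovery

variable {n : ℕ}

/-- The phase of `y j`, and `0` where `y` vanishes. -/
noncomputable def phase {ι : Type*} (y : ι → ℂ) (j : ι) : ℂ := y j / ‖y j‖

theorem norm_phase_le {ι : Type*} (y : ι → ℂ) (j : ι) : ‖phase y j‖ ≤ 1 := by
  rw [phase, norm_div, Complex.norm_real, norm_norm]
  exact div_self_le_one _

theorem conj_phase_mul_self {ι : Type*} (y : ι → ℂ) (j : ι) :
    starRingEnd ℂ (phase y j) * y j = ‖y j‖ := by
  by_cases h : y j = 0
  · simp [h]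
  · have h' : (‖y j‖ : ℂ) ≠ 0 := by simpa using h
    rw [phase, map_div₀, Complex.conj_ofReal, div_mul_eq_mul_div, Complex.conj_mul',
      div_eq_iff h', sq]

/-- A perturbation whose pairing with the phases of `y` is less than its mass off the support
increases the `ℓ¹` norm. -/
theorem l1norm_lt_of_pairing_lt {y v : Fin n → ℂ} {S : Finset (Fin n)} (hS : ∀ j, j ∉ S → y j = 0)
    (h : ‖∑ j, starRingEnd ℂ (phase y j) * v j‖ < ∑ j ∈ Sᶜ, ‖v j‖) :
    l1norm y < l1norm (y + v) := by
  have h1 : ∀ j, (starRingEnd ℂ (phase y j) * (y j + v j)).re ≤ ‖y j + v j‖ := by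
    intro j
    refine (Complex.re_le_norm _).trans ?_
    rw [norm_mul, RCLike.norm_conj]
    exact mul_le_of_le_one_left (norm_nonneg _) (norm_phase_le y j)
  have hphase : ∀ j ∈ Sᶜ, phase y j = 0 := by
    intro j hj; rw [phase, hS j (Finset.mem_compl.mp hj), zero_div]
  have h2 : ∑ j, (starRingEnd ℂ (phase y j) * (y j + v j)).re =
      l1norm y + (∑ j, starRingEnd ℂ (phase y j) * v j).re := by
    rw [l1norm, Complex.re_sum, ← Finset.sum_add_distrib]
    refine Finset.sum_congr rfl fun j _ => ?_
    rw [mul_add, conj_phase_mul_self, Complex.add_re, Complex.ofReal_re]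
  have h3 : ∑ j, (starRingEnd ℂ (phase y j) * (y j + v j)).re =
      ∑ j ∈ S, (starRingEnd ℂ (phase y j) * (y j + v j)).re := by
    rw [← Finset.sum_add_sum_compl S]
    refine add_eq_left.mpr (Finset.sum_eq_zero fun j hj => ?_)
    simp [hphase j hj]
  have h4 : ∑ j ∈ S, (starRingEnd ℂ (phase y j) * (y j + v j)).re ≤ ∑ j ∈ S, ‖y j + v j‖ :=
    Finset.sum_le_sum fun j _ => h1 j
  have h5 : ∑ j ∈ Sᶜ, ‖y j + v j‖ = ∑ j ∈ Sᶜ, ‖v j‖ :=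
    Finset.sum_congr rfl fun j hj => by rw [hS j (Finset.mem_compl.mp hj), zero_add]
  have h6 : l1norm (y + v) = ∑ j ∈ S, ‖y j + v j‖ + ∑ j ∈ Sᶜ, ‖y j + v j‖ := by
    rw [l1norm, Finset.sum_add_sum_compl]; rfl
  have h7 := (abs_le.mp (Complex.abs_re_le_norm (∑ j, starRingEnd ℂ (phase y j) * v j))).1
  linarith

theorem tvRecovers_of_nullSpaceProperty (hn : n ≠ 0) {x : Fin n → ℂ} {S : Finset (Fin n)}
    (hS : ∀ j, j ∉ S → grad x j = 0) {A : Finset ℤ}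
    (h : NullSpaceProperty (fourierVec n) S (phase (grad x)) A) : TVRecovers n ({0} ∪ A) x := by
  have key : ∀ z, sample n ({0} ∪ A) z = sample n ({0} ∪ A) x → z ≠ x →
      l1norm (grad x) < l1norm (grad z) := by
    intro z hz hzx
    have hd : ∀ k ∈ ({0} ∪ A : Finset ℤ),
        ∑ j, starRingEnd ℂ (fourierVec n k j) * (z - x) j = 0 := by
      intro k hk
      rw [← dft_eq_zero_iff hn]
      have h1 : dft n z k = dft n x k := congrFun hz ⟨k, hk⟩
      have h2 : dft n (z - x) k = dft n z k - dft n x k := by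
        simp only [dft, Pi.sub_apply, sub_mul, Finset.sum_sub_distrib, mul_sub]
      rw [h2, h1, sub_self]
    -- The only place where frequency 0 is needed: it kills the constants, which form the kernel of
    -- the gradient.
    have hv : grad (z - x) ≠ 0 := by
      intro h0
      have hconst := eq_of_grad_eq_zero h0
      have h1 := hd 0 (by simp)
      apply hzx
      funext j
      have h2 : ∀ i, starRingEnd ℂ (fourierVec n 0 i) * (z - x) i = (z - x) j := by
        intro i; rw [hconst i j, conj_fourierVec]; simp
      simp only [h2, Finset.sum_const, Finset.card_univ, Fintype.card_fin, nsmul_eq_mul,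
        mul_eq_zero, Nat.cast_eq_zero, hn, false_or] at h1
      exact sub_eq_zero.mp h1
    have := l1norm_lt_of_pairing_lt hS (h _ (fun k hk => by
      rw [sum_conj_fourierVec_mul_grad, hd k (Finset.mem_union_right _ hk), mul_zero]) hv)
    rwa [grad_sub, add_sub_cancel] at this
  refine ⟨⟨rfl, fun z hz => ?_⟩, fun z hz hmin => ?_⟩
  · by_cases hzx : z = x
    · exact (congrArg (fun z => l1norm (grad z)) hzx).ge
    · exact (key z hz hzx).le
  · by_contra hzx
    exact absurd (key z hz hzx) (not_lt.mpr (hmin rfl))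

end Recovery

/-! ### From counting to uniform measures -/

section Probability

theorem ofReal_one_sub_le_uniformOn {Ω : Type*} [MeasurableSpace Ω] [MeasurableSingletonClass Ω]
    {s : Finset Ω} (hs : s.Nonempty) {p q : Ω → Prop} [DecidablePred q] (hpq : ∀ x ∈ s, ¬ q x → p x)
    {ε : ℝ} (h : ((s.filter q).card : ℝ) ≤ s.card * ε) :
    ENNReal.ofReal (1 - ε) ≤ ProbabilityTheory.uniformOn (s : Set Ω) {x | p x} := by
  classical
  have hs0 : (0 : ℝ) < s.card := by exact_mod_cast hs.card_pos
  have hsub : ((s.filter fun x => ¬ q x : Finset Ω) : Set Ω) ⊆ {x | p x} := by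
    intro x hx
    obtain ⟨h1, h2⟩ := Finset.mem_filter.mp hx
    exact hpq x h1 h2
  refine le_trans ?_ (MeasureTheory.measure_mono hsub)
  rw [ProbabilityTheory.uniformOn_apply_finset,
    Finset.inter_eq_right.mpr (Finset.filter_subset _ s), ← ENNReal.ofReal_natCast,
    ← ENNReal.ofReal_natCast, ← ENNReal.ofReal_div_of_pos hs0]
  apply ENNReal.ofReal_le_ofReal
  rw [le_div_iff₀ hs0]
  have h1 : ((s.filter q).card : ℝ) + (s.filter fun x => ¬ q x).card = s.card := by
    exact_mod_cast Finset.card_filter_add_card_filter_not q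
  linarith

variable {F : Finset ℤ} {Q : Finset {k // k ∈ F} → Prop} [DecidablePred Q] {p : Finset ℤ → Prop}
  {m : ℕ} {ε : ℝ}

theorem ofReal_one_sub_le_uniformOn_draws (hF : F.Nonempty)
    (hQ : ∀ A, ¬ Q A → p (A.map (Function.Embedding.subtype _)))
    (h : (drawCount Q m : ℝ) ≤ (F.card : ℝ) ^ m * ε) :
    ENNReal.ofReal (1 - ε) ≤ ProbabilityTheory.uniformOn {ω : Fin m → ℤ | ∀ i, ω i ∈ F}
      {ω | p (Finset.univ.image ω)} := by
  classical
  let f : (Fin m → {k // k ∈ F}) ↪ (Fin m → ℤ) :=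
    ⟨fun ω i => ω i, fun ω ω' h => funext fun i => Subtype.ext (congrFun h i)⟩
  have hset : {ω : Fin m → ℤ | ∀ i, ω i ∈ F} = ((Finset.univ.map f : Finset (Fin m → ℤ)) : Set _) := by
    ext ω
    simp only [Set.mem_ofPred_eq, Finset.coe_map, Finset.coe_univ, Set.image_univ, Set.mem_range]
    exact ⟨fun hω => ⟨fun i => ⟨ω i, hω i⟩, rfl⟩, by rintro ⟨ω', rfl⟩ i; exact (ω' i).2⟩
  have : Nonempty {k // k ∈ F} := hF.to_subtype
  rw [hset]
  refine ofReal_one_sub_le_uniformOn (q := fun ω => ∃ ω', f ω' = ω ∧ Q (Finset.univ.image ω'))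
    (Finset.univ_nonempty.map) ?_ ?_
  · intro ω hω hq
    obtain ⟨ω', -, rfl⟩ := Finset.mem_map.mp hω
    have := hQ (Finset.univ.image ω') fun h' => hq ⟨ω', rfl, h'⟩
    rwa [Finset.map_eq_image, Finset.image_image] at this
  · rw [Finset.filter_map, Finset.card_map, Finset.card_map]
    have : (Finset.univ.filter ((fun ω => ∃ ω', f ω' = ω ∧ Q (Finset.univ.image ω')) ∘ f)).card =
        drawCount Q m := by
      unfold drawCount
      congr 1
      ext ω
      simp
    rw [this]
    simpa using h

theorem ofReal_one_sub_le_uniformOn_subsets (hm : m ≤ F.card)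
    (hQ : ∀ A, ¬ Q A → p (A.map (Function.Embedding.subtype _)))
    (h : (((Finset.powersetCard m Finset.univ).filter Q).card : ℝ) ≤ F.card.choose m * ε) :
    ENNReal.ofReal (1 - ε) ≤ ProbabilityTheory.uniformOn {T : Finset ℤ | T ⊆ F ∧ T.card = m}
      {T | p T} := by
  classical
  let f : Finset {k // k ∈ F} ↪ Finset ℤ :=
    ⟨fun A => A.map (Function.Embedding.subtype _), Finset.map_injective _⟩
  have hset : {T : Finset ℤ | T ⊆ F ∧ T.card = m} =
      (((Finset.powersetCard m Finset.univ).map f : Finset (Finset ℤ)) : Set _) := by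
    have : (Finset.powersetCard m Finset.univ).map f = Finset.powersetCard m F := by
      conv_rhs => rw [← Finset.attach_map_val (s := F)]
      rw [Finset.powersetCard_map]; rfl
    rw [this]
    ext T
    simp [Finset.mem_powersetCard]
  rw [hset]
  refine ofReal_one_sub_le_uniformOn (q := fun T => ∃ A, f A = T ∧ Q A) ?_ ?_ ?_
  · rw [Finset.map_nonempty, Finset.powersetCard_nonempty]; simpa using hm
  · intro T hT hq
    obtain ⟨A, -, rfl⟩ := Finset.mem_map.mp hT
    exact hQ A fun h' => hq ⟨A, rfl, h'⟩
  · rw [Finset.filter_map, Finset.card_map, Finset.card_map]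
    have : (Finset.powersetCard m Finset.univ).filter ((fun T => ∃ A, f A = T ∧ Q A) ∘ f) =
        (Finset.powersetCard m Finset.univ).filter Q := by
      ext A
      simp
    rw [this]
    simpa using h

end Probability

/-! ### Failure probability for the required number of draws -/

section Recovery

theorem half_pow_ceil_le {ε : ℝ} (hε : 0 < ε) : (1 / 2 : ℝ) ^ ⌈Real.log ε⁻¹ / Real.log 2⌉₊ ≤ ε := by
  have h2 : (0 : ℝ) < Real.log 2 := Real.log_pos one_lt_two
  have h := Nat.le_ceil (Real.log ε⁻¹ / Real.log 2)
  rw [div_le_iff₀ h2, ← Real.log_pow] at h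
  have h3 := (Real.log_le_log_iff (by positivity) (by positivity)).mp h
  rw [one_div, inv_pow]
  exact inv_le_of_inv_le₀ hε h3

open Classical in
theorem drawCount_not_nullSpaceProperty_le {n : ℕ} (hn : 2 ≤ n) (heven : Even n) {ε₀ : ℝ}
    (hε₀ : 0 < ε₀) (hε₀' : ε₀ < 1) {S : Finset (Fin n)} {σ : Fin n → ℂ} (hσ : ∀ j ∈ S, ‖σ j‖ ≤ 1)
    (hσ' : ∀ j ∉ S, σ j = 0) {ε : ℝ} (hε : 0 < ε) (hε' : ε ≤ ε₀) {m : ℕ}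
    (hm : 5692 * (2 + 1 / Real.log ε₀⁻¹) * S.card * Real.log n * Real.log ε⁻¹ ≤ m) :
    (drawCount (fun A => ¬ NullSpaceProperty (fun k : {k // k ∈ freqs n} => fourierVec n k) S σ A)
      m : ℝ) ≤ n ^ m * ε := by
  have hcard : Fintype.card {k // k ∈ freqs n} = n := by rw [Fintype.card_coe, card_freqs heven]
  rcases S.eq_empty_or_nonempty with rfl | hS
  -- With empty support `σ = 0`, and the null space property holds even without measurements.
  · have : drawCount (fun A =>
        ¬ NullSpaceProperty (fun k : {k // k ∈ freqs n} => fourierVec n k) ∅ σ A) m = 0 := by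
      rw [drawCount, Finset.card_eq_zero, Finset.filter_eq_empty_iff]
      intro ω _
      rw [not_not]
      intro v _ hv
      have h0 : ∑ j, starRingEnd ℂ (σ j) * v j = 0 :=
        Finset.sum_eq_zero fun j _ => by rw [hσ' j (Finset.notMem_empty j)]; simp
      obtain ⟨j, hj⟩ := Function.ne_iff.mp hv
      rw [h0, norm_zero]
      exact Finset.sum_pos' (fun _ _ => norm_nonneg _) ⟨j, by simp, norm_pos_iff.mpr hj⟩
    rw [this, Nat.cast_zero]
    positivity
  · have hs : (1 : ℝ) ≤ S.card := by exact_mod_cast hS.card_pos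
    have hn2 : (2 : ℝ) ≤ n := by exact_mod_cast hn
    have hlog2 := Real.log_two_gt_d9
    have hL : Real.log 2 ≤ Real.log n := Real.log_le_log (by norm_num) hn2
    have hΛ₀ : 0 < Real.log ε₀⁻¹ := Real.log_pos (by rw [one_lt_inv₀ hε₀]; exact hε₀')
    have hΛ : Real.log ε₀⁻¹ ≤ Real.log ε⁻¹ := by
      apply Real.log_le_log (by positivity)
      gcongr
    set L := Real.log n
    set Λ := Real.log ε⁻¹ with hΛdef
    set Λ₀ := Real.log ε₀⁻¹
    set s : ℝ := (S.card : ℝ)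
    have hsL : Real.log 2 ≤ s * L := by nlinarith
    set N := ⌈5688 * s * L⌉₊ with hNdef
    set b := ⌈Λ / Real.log 2⌉₊ with hbdef
    have hN1 : 5688 * s * L ≤ N := Nat.le_ceil _
    -- The rounding error 1 is below `4 s L`, since `s L ≥ log 2`.
    have hN2 : (N : ℝ) ≤ 5692 * s * L := by
      have := Nat.ceil_lt_add_one (a := 5688 * s * L) (by nlinarith)
      rw [← hNdef] at this
      linarith
    -- The 2 bounds `1 / log 2`, and `1 / Λ₀` absorbs the ceiling because `Λ ≥ Λ₀`; this is how `ε₀`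
    -- enters the constant.
    have hb : (b : ℝ) ≤ (2 + 1 / Λ₀) * Λ := by
      have h1 := Nat.ceil_lt_add_one (a := Λ / Real.log 2)
        (div_nonneg (hΛ₀.le.trans hΛ) (by linarith))
      rw [← hbdef] at h1
      have h2 : Λ / Real.log 2 ≤ 2 * Λ := by
        rw [div_le_iff₀ (by linarith)]; nlinarith
      have h3 : 1 ≤ 1 / Λ₀ * Λ := by
        rw [one_div, inv_mul_eq_div, one_le_div hΛ₀]; exact hΛ
      linarith
    have hNb : N * b ≤ m := by
      have : (N : ℝ) * b ≤ m := by
        calc (N : ℝ) * b ≤ (5692 * s * L) * ((2 + 1 / Λ₀) * Λ) := by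
              gcongr
          _ = 5692 * (2 + 1 / Λ₀) * s * L * Λ := by ring
          _ ≤ m := hm
      exact_mod_cast this
    have hhalf := card_not_nullSpaceProperty_le_half
      (a := fun k : {k // k ∈ freqs n} => fourierVec n k) (fun k j => norm_fourierVec n k j)
      (sum_fourierVec_mul_conj heven) (by simpa using hn) hS hσ hσ' (N := N)
      (by simpa using hN1) (by simpa using hN2)
    have h := drawCount_le_half_pow (Q := fun A =>
        ¬ NullSpaceProperty (fun k : {k // k ∈ freqs n} => fourierVec n k) S σ A)
      (fun A B hAB hB hA => hB (hA.mono hAB)) hhalf hNb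
    rw [hcard] at h
    refine h.trans ?_
    gcongr
    exact half_pow_ceil_le hε

end Recovery

theorem theorem2 (ε₀ : ℝ) (hε₀ : 0 < ε₀) (hε₀' : ε₀ < 1) :
    ∃ C : ℝ, 0 < C ∧
      ∀ (n : ℕ), 2 ≤ n → Even n →
      ∀ (s : ℕ) (x : Fin n → ℂ), IsSparse s (grad x) →
      ∀ (ε : ℝ), 0 < ε → ε ≤ ε₀ →
      ∀ (m : ℕ), C * (s : ℝ) * Real.log (n : ℝ) * Real.log ε⁻¹ ≤ (m : ℝ) →
        (m ≤ n →
          ENNReal.ofReal (1 - ε) ≤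
            subsetLaw n m {Ω' : Finset ℤ | TVRecovers n ({0} ∪ Ω') x}) ∧
        ENNReal.ofReal (1 - ε) ≤
          drawsLaw n m {ω : Fin m → ℤ | TVRecovers n ({0} ∪ Finset.univ.image ω) x} := by
  classical
  have hΛ₀ : 0 < Real.log ε₀⁻¹ := Real.log_pos (by rw [one_lt_inv₀ hε₀]; exact hε₀')
  refine ⟨5692 * (2 + 1 / Real.log ε₀⁻¹), by positivity, ?_⟩
  intro n hn heven s x hx ε hε hε' m hm
  set S : Finset (Fin n) := Finset.univ.filter fun j => grad x j ≠ 0 with hSdef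
  have hS : ∀ j, j ∉ S → grad x j = 0 := by
    intro j hj; simpa [hSdef] using hj
  have hSs : S.card ≤ s := by
    have h := hx
    rw [IsSparse, Set.ncard_eq_toFinset_card'] at h
    refine le_trans (le_of_eq ?_) h
    congr 1
    ext j
    simp [hSdef]
  have hΛ : 0 ≤ Real.log ε⁻¹ :=
    Real.log_nonneg ((one_le_inv₀ hε).mpr (hε'.trans hε₀'.le))
  have hL : 0 ≤ Real.log n := Real.log_natCast_nonneg n
  have hcount := drawCount_not_nullSpaceProperty_le hn heven hε₀ hε₀'
    (S := S) (σ := phase (grad x)) (fun j _ => norm_phase_le _ j)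
    (fun j hj => by rw [phase, hS j hj, zero_div]) hε hε' (m := m) (by
      refine le_trans ?_ hm
      gcongr)
  set Q : Finset {k // k ∈ freqs n} → Prop := fun A =>
    ¬ NullSpaceProperty (fun k : {k // k ∈ freqs n} => fourierVec n k) S (phase (grad x)) A with hQ
  have hrec : ∀ A, ¬ Q A → TVRecovers n ({0} ∪ A.map (Function.Embedding.subtype _)) x := by
    intro A hA
    refine tvRecovers_of_nullSpaceProperty (by omega) hS fun v hv hv0 => ?_
    exact not_not.mp hA v (fun k hk => hv k (Finset.mem_map_of_mem _ hk)) hv0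
  have hF : (freqs n).card = n := card_freqs heven
  constructor
  · intro hmn
    refine ofReal_one_sub_le_uniformOn_subsets (p := fun T => TVRecovers n ({0} ∪ T) x)
      (by rw [hF]; exact hmn) hrec ?_
    have h := card_powersetCard_filter_mul_le (Q := Q)
      (fun A B hAB hB hA => hB (hA.mono hAB)) (m := m) (by rw [Fintype.card_coe, hF]; exact hmn)
    rw [Fintype.card_coe, hF] at h
    rw [hF]
    have hn0 : (0 : ℝ) < (n : ℝ) ^ m := by positivity
    refine le_of_mul_le_mul_right ?_ hn0
    calc _ ≤ ((n.choose m : ℕ) : ℝ) * drawCount Q m := by exact_mod_cast h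
      _ ≤ n.choose m * (n ^ m * ε) := by gcongr
      _ = _ := by ring
  · refine ofReal_one_sub_le_uniformOn_draws (p := fun T => TVRecovers n ({0} ∪ T) x)
      (Finset.card_pos.mp (by omega)) hrec ?_
    rw [hF]; exact hcount
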